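/- **Proposition (Unadjusted HMC).** Let $d\ge 1$, $0<\alpha\le\beta$, $\kappa=\beta/\alpha$, and let $B\in\mathbb R^{d\times d}$ be a symmetric matrix with $\alpha I\preceq B\preceq \beta I$. Put $f(x)=\tfrac12 x^\top Bx$ and let $\pi$ be the probability measure on $\mathbb R^d$ with density proportional to $e^{-f(x)}$. For $\delta>0$, a leapfrog step of size $\delta$ maps $(x,v)\in\mathbb R^d\times\mathbb R^d$ to $(x',v')$, where $$v_{1/2}=v-\tfrac{\delta}{2}\nabla f(x),\qquad x'=x+\delta v_{1/2},\qquad v'=v_{1/2}-\tfrac{\delta}{2}\nabla f(x').$$ Let $\mathcal T=\{k\delta : k\in\mathbb Z_{\ge 0},\ k\delta<10\pi/\sqrt\alpha\}$ (here $\pi$ is the number). Let $\hat Q$ be the Markov kernel of unadjusted leapfrog HMC with random integration times: from $x$, draw independently $v\sim\mathcal N(0,I_d)$ and $t$ uniformly from $\mathcal T$, apply $t/\delta$ leapfrog steps to $(x,v)$, and output the resulting position. Write $\hat Q^K_x$ for the distribution after $K$ transitions started from $x$, and $\|\mu-\nu\|_{\mathrm{TV}}=\sup_A|\mu(A)-\nu(A)|$.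 There exist absolute constants $C>0$, $0<C'\le 1$ and $C''>0$ such that the following holds for all $d,\alpha,\beta,B$ as above, all $\varepsilon>0$, $x\in\mathbb R^d$, $K\in\mathbb Z_{\ge0}$ and $\delta>0$. If $$K\ \ge\ C\log\left(\frac{d\kappa(\sqrt\alpha\,\|x\|_\infty+1)}{\varepsilon}\right)\qquad\text{and}\qquad \delta\ \le\ C'\,\frac{\sqrt\varepsilon}{\sqrt\beta\,d^{1/4}},$$ then $$\|\hat Q^K_x-\pi\|_{\mathrm{TV}}\le\varepsilon .$$ Moreover, executing the $K$ transitions, with access to $f$ only through evaluations of $\nabla f$ (two per leapfrog step), returns a sample from $\hat Q^K_x$, and if $\delta\ge c\,\sqrt\varepsilon/(\sqrt\beta\,d^{1/4})$ for some $c>0$ (for instance $c=C'$, with $\delta$ the largest allowed step size), then it almost surely uses at most $$\frac{C''}{c}\cdot\frac{\sqrt\kappa\,d^{1/4}K}{\sqrt\varepsilon}$$ gradient evaluations. -/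

import Mathlib

open MeasureTheory ProbabilityTheory

noncomputable section

namespace UnadjustedHMC

/-- The space `ℝ^d` with its Euclidean structure. -/
abbrev Vec (d : ℕ) : Type := EuclideanSpace ℝ (Fin d)

/-- The potential `f(x) = ½ xᵀ B x`. -/
def potential {d : ℕ} (B : Matrix (Fin d) (Fin d) ℝ) (x : Vec d) : ℝ :=
  (1 / 2) * (x.ofLp ⬝ᵥ (B.mulVec x.ofLp))

/-- The target measure with Lebesgue density `exp(-f(x)) / ∫ exp(-f)`, where `f(x) = ½ xᵀ B x`;
for positive definite `B` it is the centred Gaussian with precision matrix `B`. -/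
def target {d : ℕ} (B : Matrix (Fin d) (Fin d) ℝ) : Measure (Vec d) :=
  (volume : Measure (Vec d)).tilted (fun x => -potential B x)

/-- The sup norm `‖x‖_∞ = max_i |x_i|`. -/
def supNorm {d : ℕ} (x : Vec d) : ℝ := ‖x.ofLp‖

/-- Total variation distance `sup_A |μ(A) - ν(A)|` over measurable sets `A`
(used for probability measures only). -/
def tvDist {Ω : Type*} [MeasurableSpace Ω] (μ ν : Measure Ω) : ℝ :=
  ⨆ A : {A : Set Ω // MeasurableSet A}, |μ.real A.1 - ν.real A.1|

/-- One step of size `δ` of the leapfrog (Störmer-Verlet) integrator for the Hamiltonian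
`H(x, v) = f(x) + ½ ‖v‖²`, where `g = ∇f`:
half a momentum update, a full position update, half a momentum update. -/
def leapfrogStep {d : ℕ} (g : Vec d → Vec d) (δ : ℝ) (z : Vec d × Vec d) : Vec d × Vec d :=
  let vHalf := z.2 - (δ / 2) • g z.1
  let x' := z.1 + δ • vHalf
  (x', vHalf - (δ / 2) • g x')

/-- `k` leapfrog steps of size `δ`, that is, integration time `t = k δ`. -/
def leapfrog {d : ℕ} (g : Vec d → Vec d) (δ : ℝ) (k : ℕ) (z : Vec d × Vec d) : Vec d × Vec d :=
  (leapfrogStep g δ)^[k] z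

/-- The admissible numbers of leapfrog steps: `k` is in this set iff `k δ` belongs to the set
`{k δ | k ∈ ℕ, k δ < 10 π / √α}` of integration times. -/
def stepCounts (α δ : ℝ) : Set ℕ := {k : ℕ | (k : ℝ) * δ < 10 * Real.pi / √α}

/-- The random draws of one transition: a momentum `v ∼ N(0, I_d)` and, independently,
an integration time `t = k δ` uniform on the admissible times, recorded through `k`. -/
def drawLaw (d : ℕ) (α δ : ℝ) : Measure (Vec d × ℕ) :=
  (stdGaussian (Vec d)).prod (uniformOn (stepCounts α δ))

/-- The Markov kernel of unadjusted leapfrog HMC with random integration time: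
from `x`, draw `(v, k)`, run `k` leapfrog steps from `(x, v)` and keep the position. -/
def hmcKernel {d : ℕ} (B : Matrix (Fin d) (Fin d) ℝ) (α δ : ℝ) : Kernel (Vec d) (Vec d) :=
  (Kernel.id ×ₖ Kernel.const (Vec d) (drawLaw d α δ)).map
    (fun p => (leapfrog (gradient (potential B)) δ p.2.2 (p.1, p.2.1)).1)

/-- Programs that may query an oracle `E → E` (here: the gradient of the potential)
and finally return a value of type `R`. -/
inductive OracleProg (E R : Type) : Type where
  /-- stop and return a value -/
  | ret (r : R) : OracleProg E R
  /-- query the oracle at `x` and continue with its answer -/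
  | query (x : E) (cont : E → OracleProg E R) : OracleProg E R

namespace OracleProg

/-- Sequential composition. -/
def andThen {E R S : Type} : OracleProg E R → (R → OracleProg E S) → OracleProg E S
  | ret r, h => h r
  | query x cont, h => query x (fun a => (cont a).andThen h)

/-- The value returned when queries are answered by `g`. -/
def output {E R : Type} (g : E → E) : OracleProg E R → R
  | ret r => r
  | query x cont => (cont (g x)).output g

/-- The number of queries made when queries are answered by `g`. -/
def queries {E R : Type} (g : E → E) : OracleProg E R → ℕ
  | ret _ => 0
  | query x cont => (cont (g x)).queries g + 1

end OracleProg

/-- A leapfrog step as a program that queries the gradient. -/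
def leapfrogStepProg {d : ℕ} (δ : ℝ) (z : Vec d × Vec d) : OracleProg (Vec d) (Vec d × Vec d) :=
  .query z.1 fun a =>
    let vHalf := z.2 - (δ / 2) • a
    let x' := z.1 + δ • vHalf
    .query x' fun b => .ret (x', vHalf - (δ / 2) • b)

/-- `k` leapfrog steps as a program. -/
def leapfrogProg {d : ℕ} (δ : ℝ) : ℕ → Vec d × Vec d → OracleProg (Vec d) (Vec d × Vec d)
  | 0, z => .ret z
  | k + 1, z => (leapfrogStepProg δ z).andThen (leapfrogProg δ k)

/-- One HMC transition from `x` with random draws `ξ = (v, k)`, as a program. -/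
def hmcStepProg {d : ℕ} (δ : ℝ) (ξ : Vec d × ℕ) (x : Vec d) : OracleProg (Vec d) (Vec d) :=
  (leapfrogProg δ ξ.2 (x, ξ.1)).andThen fun z => .ret z.1

/-- `K` HMC transitions started from `x` with random draws `ξ 0, …, ξ (K - 1)`, as a program.
The potential enters only through the answers to the gradient queries. -/
def hmcProg {d : ℕ} (δ : ℝ) : (K : ℕ) → (Fin K → Vec d × ℕ) → Vec d → OracleProg (Vec d) (Vec d)
  | 0, _, x => .ret x
  | K + 1, ξ, x => (hmcProg δ K (Fin.init ξ) x).andThen (hmcStepProg δ (ξ (Fin.last K)))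

/-- The joint law of the random draws of `K` transitions (independent copies). -/
def drawsLaw (d : ℕ) (α δ : ℝ) (K : ℕ) : Measure (Fin K → Vec d × ℕ) :=
  Measure.pi fun _ => drawLaw d α δ

end UnadjustedHMC

end

open UnadjustedHMC

/-!
In an eigenbasis of `B` a leapfrog step acts on each coordinate separately, and on the coordinate
with eigenvalue `l` it is conjugate to the rotation by the angle `θ` with `cos θ = 1 - δ² l / 2`.
Hence, given the integration times `k₁ δ, …, k_K δ`, the chain started at `x` is Gaussian with
independent coordinates of mean `R y` and variance `(1 - R²) τ`, where `y` is the coordinate of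
`x`, `R = ∏ cos (kᵢ θ)`, and `τ = 1 / (l (1 - δ² l / 4))` is the variance `1 / l` of the target up
to a discretization error of relative size `u = δ² l / 4`.

By tensorization of the Hellinger affinity, the squared total variation distance between such a
law and the target is at most `∑ (8/7 u² + w R²)` with `w = 8/7 + l y² / 2`, which is affine in
the numbers `R²`. By Jensen's inequality the bound survives averaging over the integration times,
and since the admissible times cover several periods of every coordinate, averaging over one
transition multiplies the expectation of `R²` by at most `3/4`. So the distance to the target is
controlled by the bias `∑ u²`, which is of order `d (δ² β)²`, plus `(3/4) ^ K ∑ w`.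
-/

noncomputable section

namespace UnadjustedHMC

/-! ### Markov chains driven by random mappings -/

section RandomMapping

variable {Ω Ξ : Type*}

/-- The state reached from `x` by the random mapping `F` after `K` transitions
with draws `ξ 0, …, ξ (K - 1)`. -/
def randomMapIterate (F : Ω × Ξ → Ω) (x : Ω) : (K : ℕ) → (Fin K → Ξ) → Ω
  | 0, _ => x
  | K + 1, ξ => F (randomMapIterate F x K (Fin.init ξ), ξ (Fin.last K))

variable [MeasurableSpace Ω] [MeasurableSpace Ξ] {F : Ω × Ξ → Ω} {ν : Measure Ξ}

/-- The transition kernel of the Markov chain which from `x` moves to `F (x, ξ)` with a fresh draw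
`ξ ∼ ν`. -/
def randomMapKernel (F : Ω × Ξ → Ω) (ν : Measure Ξ) : Kernel Ω Ω :=
  (Kernel.id ×ₖ Kernel.const Ω ν).map F

theorem isMarkovKernel_randomMapKernel [IsProbabilityMeasure ν] (hF : Measurable F) :
    IsMarkovKernel (randomMapKernel F ν) :=
  Kernel.IsMarkovKernel.map _ hF

theorem isMarkovKernel_pow (κ : Kernel Ω Ω) [IsMarkovKernel κ] (K : ℕ) :
    IsMarkovKernel (κ ^ K) := by
  induction K with
  | zero => exact inferInstanceAs (IsMarkovKernel Kernel.id)
  | succ K ih =>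
    rw [pow_succ]
    exact inferInstanceAs (IsMarkovKernel ((κ ^ K) ∘ₖ κ))

theorem bind_randomMapKernel [SFinite ν] (hF : Measurable F) (μ : Measure Ω) [SFinite μ] :
    μ.bind (randomMapKernel F ν) = (μ.prod ν).map F := by
  rw [randomMapKernel, ← Measure.map_comp _ _ hF, ← Measure.compProd_eq_comp_prod,
    Measure.compProd_const]

theorem pow_succ_kernel_apply (κ : Kernel Ω Ω) (K : ℕ) (x : Ω) :
    (κ ^ (K + 1)) x = ((κ ^ K) x).bind κ := by
  rw [pow_succ']
  rfl

theorem measurable_randomMapIterate (hF : Measurable F) (x : Ω) (K : ℕ) :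
    Measurable (randomMapIterate F x K) := by
  induction K with
  | zero => exact measurable_const
  | succ K ih =>
    have h_init : Measurable (Fin.init : (Fin (K + 1) → Ξ) → Fin K → Ξ) :=
      measurable_pi_lambda _ fun i => measurable_pi_apply _
    exact hF.comp ((ih.comp h_init).prodMk (measurable_pi_apply _))

theorem map_init_last_pi (ν : Measure Ξ) [SigmaFinite ν] (K : ℕ) :
    (Measure.pi fun _ : Fin (K + 1) => ν).map (fun ξ => (Fin.init ξ, ξ (Fin.last K)))
      = (Measure.pi fun _ : Fin K => ν).prod ν := by
  have h := (measurePreserving_piFinSuccAbove (fun _ : Fin (K + 1) => ν) (Fin.last K)).map_eq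
  rw [← Measure.prod_swap, ← h, Measure.map_map measurable_swap (MeasurableEquiv.measurable _)]
  congr 1
  funext ξ
  simp only [Function.comp, MeasurableEquiv.piFinSuccAbove_apply, Fin.insertNthEquiv_last,
    Fin.snocEquiv_symm_apply, Prod.swap]

theorem map_randomMapIterate [IsProbabilityMeasure ν] (hF : Measurable F) (x : Ω) (K : ℕ) :
    (Measure.pi fun _ : Fin K => ν).map (randomMapIterate F x K)
      = (randomMapKernel F ν ^ K) x := by
  have := isMarkovKernel_randomMapKernel (ν := ν) hF
  induction K with
  | zero =>
    have h_const : randomMapIterate F x 0 = fun _ : Fin 0 → Ξ => x := rfl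
    rw [h_const, Measure.map_const, measure_univ, one_smul, pow_zero]
    exact (Kernel.id_apply x).symm
  | succ K ih =>
    have := isMarkovKernel_pow (randomMapKernel F ν) K
    have hK := measurable_randomMapIterate hF x K
    have h_init : Measurable
        fun ξ : Fin (K + 1) → Ξ => ((Fin.init ξ : Fin K → Ξ), ξ (Fin.last K)) :=
      (measurable_pi_lambda _ fun i => measurable_pi_apply _).prodMk (measurable_pi_apply _)
    rw [pow_succ_kernel_apply, bind_randomMapKernel hF, ← ih]
    nth_rw 3 [← Measure.map_id (μ := ν)]
    rw [Measure.map_prod_map _ _ hK measurable_id, Measure.map_map hF (by fun_prop),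
      ← map_init_last_pi, Measure.map_map (by fun_prop) h_init]
    rfl

end RandomMapping

/-! ### Oracle programs -/

namespace OracleProg

variable {E R S : Type} (g : E → E) (p : OracleProg E R) (h : R → OracleProg E S)

theorem output_andThen : (p.andThen h).output g = (h (p.output g)).output g := by
  induction p with
  | ret r => rfl
  | query x _ ih => exact ih (g x)

theorem queries_andThen :
    (p.andThen h).queries g = p.queries g + (h (p.output g)).queries g := by
  induction p with
  | ret r => exact (Nat.zero_add _).symm
  | query x _ ih =>
    simp only [andThen, queries, output, ih]
    omega

end OracleProg

section Programs

variable {d : ℕ} (g : Vec d → Vec d) (δ : ℝ)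

/-- The position after one transition, as a function of the state and the draws `(v, k)`. -/
def hmcStep (p : Vec d × (Vec d × ℕ)) : Vec d :=
  (leapfrog g δ p.2.2 (p.1, p.2.1)).1

theorem output_leapfrogProg (k : ℕ) (z : Vec d × Vec d) :
    (leapfrogProg δ k z).output g = leapfrog g δ k z := by
  induction k generalizing z with
  | zero => rfl
  | succ k ih =>
    rw [leapfrogProg, OracleProg.output_andThen, ih]
    rfl

theorem queries_leapfrogProg (k : ℕ) (z : Vec d × Vec d) :
    (leapfrogProg δ k z).queries g = 2 * k := by
  induction k generalizing z with
  | zero => rfl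
  | succ k ih =>
    rw [leapfrogProg, OracleProg.queries_andThen, ih]
    simp only [leapfrogStepProg, OracleProg.queries]
    omega

theorem output_hmcProg (K : ℕ) (ξ : Fin K → Vec d × ℕ) (x : Vec d) :
    (hmcProg δ K ξ x).output g = randomMapIterate (hmcStep g δ) x K ξ := by
  induction K with
  | zero => rfl
  | succ K ih =>
    rw [hmcProg, OracleProg.output_andThen, hmcStepProg, OracleProg.output_andThen,
      output_leapfrogProg, ih]
    rfl

theorem queries_hmcProg (K : ℕ) (ξ : Fin K → Vec d × ℕ) (x : Vec d) :
    (hmcProg δ K ξ x).queries g = ∑ i, 2 * (ξ i).2 := by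
  induction K with
  | zero => rfl
  | succ K ih =>
    rw [hmcProg, OracleProg.queries_andThen, ih, hmcStepProg, OracleProg.queries_andThen,
      queries_leapfrogProg, Fin.sum_univ_castSucc]
    rfl

variable {g} in
theorem measurable_hmcStep (hg : Measurable g) : Measurable (hmcStep g δ) := by
  have h_step : Measurable (leapfrogStep g δ) := by
    unfold leapfrogStep
    fun_prop
  have h_position : Measurable fun q : (Vec d × Vec d) × ℕ => (leapfrog g δ q.2 q.1).1 :=
    measurable_from_prod_countable_left fun k => (h_step.iterate k).fst
  exact h_position.comp (f := fun p : Vec d × (Vec d × ℕ) => ((p.1, p.2.1), p.2.2)) (by fun_prop)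

end Programs

/-! ### The law of the draws -/

section Draws

variable {α δ : ℝ}

theorem stepCounts_eq_range (α : ℝ) (hδ : 0 < δ) :
    stepCounts α δ = (Finset.range ⌈10 * Real.pi / √α / δ⌉₊ : Set ℕ) := by
  ext k
  simp [stepCounts, Nat.lt_ceil, lt_div_iff₀ hδ]

theorem ceil_steps_pos (hα : 0 < α) (hδ : 0 < δ) : 0 < ⌈10 * Real.pi / √α / δ⌉₊ := by
  have := Real.pi_pos
  rw [Nat.ceil_pos]
  positivity

theorem isProbabilityMeasure_uniformOn_stepCounts (hα : 0 < α) (hδ : 0 < δ) :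
    IsProbabilityMeasure (uniformOn (stepCounts α δ)) := by
  rw [stepCounts_eq_range α hδ]
  exact isProbabilityMeasure_uniformOn (Finset.finite_toSet _)
    ⟨0, by simpa using ceil_steps_pos hα hδ⟩

variable (d : ℕ)

theorem isProbabilityMeasure_drawLaw (hα : 0 < α) (hδ : 0 < δ) :
    IsProbabilityMeasure (drawLaw d α δ) := by
  have := isProbabilityMeasure_uniformOn_stepCounts hα hδ
  rw [drawLaw]
  infer_instance

theorem ae_drawLaw_mem_stepCounts (hα : 0 < α) (hδ : 0 < δ) :
    ∀ᵐ ξ ∂drawLaw d α δ, ξ.2 ∈ stepCounts α δ := by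
  have := isProbabilityMeasure_uniformOn_stepCounts hα hδ
  exact Measure.quasiMeasurePreserving_snd.ae (p := (· ∈ stepCounts α δ))
    (ae_cond_mem MeasurableSet.of_discrete)

theorem ae_drawsLaw_mem_stepCounts (hα : 0 < α) (hδ : 0 < δ) (K : ℕ) :
    ∀ᵐ ξ ∂drawsLaw d α δ K, ∀ i, (ξ i).2 ∈ stepCounts α δ := by
  have := isProbabilityMeasure_drawLaw d hα hδ
  rw [ae_all_iff]
  intro i
  exact (measurePreserving_eval (fun _ => drawLaw d α δ) i).quasiMeasurePreserving.ae
    (ae_drawLaw_mem_stepCounts d hα hδ)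

variable {d} in
theorem ae_queries_hmcProg_le (g : Vec d → Vec d) (hα : 0 < α) (hδ : 0 < δ) (K : ℕ) (x : Vec d) :
    ∀ᵐ ξ ∂drawsLaw d α δ K,
      ((hmcProg δ K ξ x).queries g : ℝ) ≤ K * (2 * (10 * Real.pi / √α / δ)) := by
  filter_upwards [ae_drawsLaw_mem_stepCounts d hα hδ K] with ξ hξ
  rw [queries_hmcProg, Nat.cast_sum]
  calc ∑ i, ((2 * (ξ i).2 : ℕ) : ℝ) ≤ ∑ _i : Fin K, 2 * (10 * Real.pi / √α / δ) := by
        push_cast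
        gcongr with i
        exact ((lt_div_iff₀ hδ).2 (hξ i)).le
    _ = K * (2 * (10 * Real.pi / √α / δ)) := by simp

end Draws

/-! ### Total variation and Hellinger affinity -/

section Hellinger

variable {Ω : Type*} [MeasurableSpace Ω] {μ : Measure Ω} {f p q : Ω → ℝ} {A : Set Ω}

theorem two_mul_abs_setIntegral_le (hf : Integrable f μ) (hf0 : ∫ x, f x ∂μ = 0)
    (hA : MeasurableSet A) : 2 * |∫ x in A, f x ∂μ| ≤ ∫ x, |f x| ∂μ := by
  have h_compl : |∫ x in A, f x ∂μ| = |∫ x in Aᶜ, f x ∂μ| := by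
    rw [setIntegral_compl hA hf, hf0, zero_sub, abs_neg]
  calc 2 * |∫ x in A, f x ∂μ| = |∫ x in A, f x ∂μ| + |∫ x in Aᶜ, f x ∂μ| := by
        rw [two_mul, ← h_compl]
    _ ≤ ∫ x in A, |f x| ∂μ + ∫ x in Aᶜ, |f x| ∂μ :=
        add_le_add abs_integral_le_integral_abs abs_integral_le_integral_abs
    _ = ∫ x, |f x| ∂μ := integral_add_compl hA hf.abs

theorem sq_integral_mul_le (hp : MemLp p 2 μ) (hq : MemLp q 2 μ) (hp0 : ∀ x, 0 ≤ p x)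
    (hq0 : ∀ x, 0 ≤ q x) :
    (∫ x, p x * q x ∂μ) ^ 2 ≤ (∫ x, p x ^ 2 ∂μ) * ∫ x, q x ^ 2 ∂μ := by
  have h_holder := integral_mul_le_Lp_mul_Lq_of_nonneg Real.HolderConjugate.two_two
    (ae_of_all _ hp0) (ae_of_all _ hq0) (by simpa using hp) (by simpa using hq)
  simp only [Real.rpow_two, ← Real.sqrt_eq_rpow] at h_holder
  rw [← Real.sqrt_mul (integral_nonneg fun x => sq_nonneg _)] at h_holder
  exact (Real.le_sqrt (integral_nonneg fun x => mul_nonneg (hp0 x) (hq0 x)) (by positivity)).1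
    h_holder

theorem memLp_two_sqrt (hp : Integrable p μ) (hp0 : ∀ x, 0 ≤ p x) :
    MemLp (fun x => √(p x)) 2 μ := by
  rw [memLp_two_iff_integrable_sq (Real.continuous_sqrt.comp_aestronglyMeasurable hp.1)]
  simpa only [Real.sq_sqrt (hp0 _)] using hp

theorem sq_integral_abs_sub_le (hp : Integrable p μ) (hq : Integrable q μ) (hp0 : ∀ x, 0 ≤ p x)
    (hq0 : ∀ x, 0 ≤ q x) (hp1 : ∫ x, p x ∂μ = 1) (hq1 : ∫ x, q x ∂μ = 1) :
    (∫ x, |p x - q x| ∂μ) ^ 2 ≤ 4 * (1 - (∫ x, √(p x * q x) ∂μ) ^ 2) := by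
  have hp2 := memLp_two_sqrt hp hp0
  have hq2 := memLp_two_sqrt hq hq0
  have h_sum : Integrable (fun x => p x + q x) μ := hp.add hq
  have hpq : Integrable (fun x => √(p x * q x)) μ :=
    (hp2.integrable_mul hq2).congr (ae_of_all _ fun x => (Real.sqrt_mul (hp0 x) _).symm)
  have h_factor (x : Ω) : |p x - q x| = |√(p x) - √(q x)| * (√(p x) + √(q x)) := by
    rw [← abs_of_nonneg (a := √(p x) + √(q x)) (by positivity), ← abs_mul, mul_comm, ← sq_sub_sq,
      Real.sq_sqrt (hp0 x), Real.sq_sqrt (hq0 x)]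
  have h_sub (x : Ω) : |√(p x) - √(q x)| ^ 2 = p x + q x - 2 * √(p x * q x) := by
    rw [sq_abs, sub_sq, Real.sq_sqrt (hp0 x), Real.sq_sqrt (hq0 x), Real.sqrt_mul (hp0 x)]
    ring
  have h_add (x : Ω) : (√(p x) + √(q x)) ^ 2 = p x + q x + 2 * √(p x * q x) := by
    rw [add_sq, Real.sq_sqrt (hp0 x), Real.sq_sqrt (hq0 x), Real.sqrt_mul (hp0 x)]
    ring
  calc (∫ x, |p x - q x| ∂μ) ^ 2
      ≤ (∫ x, |√(p x) - √(q x)| ^ 2 ∂μ) * ∫ x, (√(p x) + √(q x)) ^ 2 ∂μ := by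
        simp_rw [h_factor]
        exact sq_integral_mul_le (hp2.sub hq2).abs (hp2.add hq2) (fun _ => abs_nonneg _)
          fun _ => by positivity
    _ = (2 - 2 * ∫ x, √(p x * q x) ∂μ) * (2 + 2 * ∫ x, √(p x * q x) ∂μ) := by
        simp_rw [h_sub, h_add]
        rw [integral_sub h_sum (hpq.const_mul 2), integral_add h_sum (hpq.const_mul 2),
          integral_add hp hq, integral_const_mul, hp1, hq1, one_add_one_eq_two]
    _ = 4 * (1 - (∫ x, √(p x * q x) ∂μ) ^ 2) := by ring

theorem sq_setIntegral_sub_le (hp : Integrable p μ) (hq : Integrable q μ) (hp0 : ∀ x, 0 ≤ p x)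
    (hq0 : ∀ x, 0 ≤ q x) (hp1 : ∫ x, p x ∂μ = 1) (hq1 : ∫ x, q x ∂μ = 1) (hA : MeasurableSet A) :
    (∫ x in A, p x ∂μ - ∫ x in A, q x ∂μ) ^ 2 ≤ 1 - (∫ x, √(p x * q x) ∂μ) ^ 2 := by
  have h_diff : ∫ x, (p x - q x) ∂μ = 0 := by rw [integral_sub hp hq, hp1, hq1, sub_self]
  have h_abs := two_mul_abs_setIntegral_le (hp.sub hq) h_diff hA
  simp only [Pi.sub_apply] at h_abs
  rw [integral_sub hp.restrict hq.restrict] at h_abs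
  have h_sq := (pow_le_pow_left₀ (by positivity) h_abs 2).trans
    (sq_integral_abs_sub_le hp hq hp0 hq0 hp1 hq1)
  rw [mul_pow, sq_abs] at h_sq
  linarith

theorem sq_measureReal_sub_le_one {P Q : Measure Ω} [IsProbabilityMeasure P]
    [IsProbabilityMeasure Q] : (P.real A - Q.real A) ^ 2 ≤ 1 := by
  rw [sq_le_one_iff_abs_le_one]
  exact abs_sub_le_of_nonneg_of_le measureReal_nonneg measureReal_le_one measureReal_nonneg
    measureReal_le_one

theorem tvDist_le {P Q : Measure Ω} {c : ℝ} (hc : 0 ≤ c)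
    (h : ∀ A, MeasurableSet A → (P.real A - Q.real A) ^ 2 ≤ c ^ 2) : tvDist P Q ≤ c := by
  have : Nonempty {A : Set Ω // MeasurableSet A} := ⟨⟨∅, MeasurableSet.empty⟩⟩
  exact ciSup_le fun A => abs_le_of_sq_le_sq (h A.1 A.2) hc

end Hellinger

theorem one_sub_prod_le_sum {ι : Type*} (s : Finset ι) {a : ι → ℝ} (h0 : ∀ i, 0 ≤ a i)
    (h1 : ∀ i, a i ≤ 1) : 1 - ∏ i ∈ s, a i ≤ ∑ i ∈ s, (1 - a i) := by
  classical
  induction s using Finset.induction_on with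
  | empty => simp
  | insert i s hi ih =>
    rw [Finset.prod_insert hi, Finset.sum_insert hi]
    have h_prod : ∏ j ∈ s, a j ≤ 1 := Finset.prod_le_one (fun j _ => h0 j) (fun j _ => h1 j)
    nlinarith [h0 i, h1 i]

/-! ### Products of real Gaussian measures -/

section GaussianProducts

open scoped NNReal

/-- The squared Hellinger affinity of the Gaussian measures `N(m, s)` and `N(n, t)`.
It vanishes if one of the variances does, also when the quotient is the junk value `0 / 0`. -/
def gaussianAffinitySq (m s n t : ℝ) : ℝ :=
  2 * √(s * t) / (s + t) * Real.exp (-((m - n) ^ 2 / (2 * (s + t))))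

theorem gaussianAffinitySq_nonneg (m n : ℝ) {s t : ℝ} (hs : 0 ≤ s) (ht : 0 ≤ t) :
    0 ≤ gaussianAffinitySq m s n t := by
  unfold gaussianAffinitySq
  positivity

theorem gaussianAffinitySq_le_one (m n : ℝ) {s t : ℝ} (hs : 0 ≤ s) (ht : 0 ≤ t) :
    gaussianAffinitySq m s n t ≤ 1 := by
  have h_ratio : 2 * √(s * t) / (s + t) ≤ 1 := by
    refine div_le_one_of_le₀ ?_ (by positivity)
    rw [Real.sqrt_mul hs]
    linarith [two_mul_le_add_sq √s √t, Real.sq_sqrt hs, Real.sq_sqrt ht]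
  refine mul_le_one₀ h_ratio (Real.exp_pos _).le ?_
  rw [Real.exp_le_one_iff, neg_nonpos]
  positivity

theorem gaussianAffinitySq_eq_zero (m n : ℝ) {s t : ℝ} (h : s = 0 ∨ t = 0) :
    gaussianAffinitySq m s n t = 0 := by
  rcases h with rfl | rfl <;> simp [gaussianAffinitySq]

theorem one_sub_gaussianAffinitySq_le (m n : ℝ) {s t : ℝ} (hs : 0 ≤ s) (ht : 0 < t) :
    1 - gaussianAffinitySq m s n t ≤ (1 - s / t) ^ 2 + (m - n) ^ 2 / (2 * t) := by
  have h_scale : 1 - 2 * √(s * t) / (s + t) ≤ (1 - s / t) ^ 2 := by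
    have hs2 := Real.sq_sqrt hs
    have ht2 := Real.sq_sqrt ht.le
    calc 1 - 2 * √(s * t) / (s + t) = (√t - √s) ^ 2 / (s + t) := by
          rw [Real.sqrt_mul hs, eq_div_iff (by positivity), sub_mul,
            div_mul_cancel₀ _ (by positivity)]
          linear_combination -hs2 - ht2
      _ ≤ (√t - √s) ^ 2 * ((√t + √s) ^ 2 / t) / t := by
          gcongr
          · refine le_mul_of_one_le_right (sq_nonneg _) ((one_le_div ht).2 ?_)
            rw [← ht2]
            gcongr
            rw [Real.sqrt_sq (Real.sqrt_nonneg t)]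
            exact le_add_of_nonneg_right (Real.sqrt_nonneg s)
          · exact le_add_of_nonneg_left hs
      _ = ((√t ^ 2 - √s ^ 2) / t) ^ 2 := by
          field_simp
          ring
      _ = (1 - s / t) ^ 2 := by rw [hs2, ht2, sub_div, div_self ht.ne']
  have h_shift : (m - n) ^ 2 / (2 * (s + t)) ≤ (m - n) ^ 2 / (2 * t) := by
    gcongr
    exact le_add_of_nonneg_left hs
  have h_ratio : 2 * √(s * t) / (s + t) ≤ 1 := by
    simpa [gaussianAffinitySq] using gaussianAffinitySq_le_one 0 0 hs ht.le
  have h_ratio_nonneg : 0 ≤ 2 * √(s * t) / (s + t) := by positivity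
  have h_shift_nonneg : 0 ≤ (m - n) ^ 2 / (2 * (s + t)) := by positivity
  have h_exp := mul_le_mul_of_nonneg_left
    (Real.one_sub_le_exp_neg ((m - n) ^ 2 / (2 * (s + t)))) h_ratio_nonneg
  rw [gaussianAffinitySq]
  nlinarith

theorem sqrt_gaussianPDFReal_mul (m n : ℝ) {s t : ℝ≥0} (hs : s ≠ 0) (ht : t ≠ 0) (x : ℝ) :
    √(gaussianPDFReal m s x * gaussianPDFReal n t x)
      = √((√(2 * Real.pi * s))⁻¹ * (√(2 * Real.pi * t))⁻¹)
          * Real.exp (-((m - n) ^ 2 / (4 * (s + t))))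
          * Real.exp (-((s + t) / (4 * s * t) : ℝ) * (x - (m * t + n * s) / (s + t)) ^ 2) := by
  have : (0 : ℝ) < s := by positivity
  have : (0 : ℝ) < t := by positivity
  have h_sq : gaussianPDFReal m s x * gaussianPDFReal n t x
      = ((√(2 * Real.pi * s))⁻¹ * (√(2 * Real.pi * t))⁻¹)
        * (Real.exp (-((m - n) ^ 2 / (4 * (s + t))))
          * Real.exp (-((s + t) / (4 * s * t) : ℝ) * (x - (m * t + n * s) / (s + t)) ^ 2)) ^ 2 := by
    rw [gaussianPDFReal, gaussianPDFReal, mul_mul_mul_comm, ← Real.exp_add, ← Real.exp_add,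
      ← Real.exp_nat_mul]
    congr 2
    field_simp
    ring
  rw [h_sq, Real.sqrt_mul (by positivity), Real.sqrt_sq (by positivity)]
  exact (mul_assoc _ _ _).symm

theorem sq_integral_sqrt_gaussianPDFReal_mul (m n : ℝ) {s t : ℝ≥0} (hs : s ≠ 0) (ht : t ≠ 0) :
    (∫ x, √(gaussianPDFReal m s x * gaussianPDFReal n t x)) ^ 2
      = gaussianAffinitySq m s n t := by
  have : (0 : ℝ) < s := by positivity
  have : (0 : ℝ) < t := by positivity
  have := Real.pi_pos
  have h_const : (√(2 * Real.pi * s))⁻¹ * (√(2 * Real.pi * t))⁻¹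
      = (2 * Real.pi * √(s * t))⁻¹ := by
    rw [← mul_inv, ← Real.sqrt_mul (by positivity),
      show 2 * Real.pi * s * (2 * Real.pi * t) = (2 * Real.pi) ^ 2 * (s * t) by ring,
      Real.sqrt_mul (by positivity), Real.sqrt_sq (by positivity)]
  have h_exp : Real.exp (-((m - n) ^ 2 / (4 * (s + t)))) ^ 2
      = Real.exp (-((m - n) ^ 2 / (2 * (s + t)))) := by
    rw [← Real.exp_nat_mul]
    congr 1
    push_cast
    field_simp
    ring
  have h_sqrt : √(s * t : ℝ) ^ 2 = s * t := Real.sq_sqrt (by positivity)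
  have : 0 < √(s * t : ℝ) := by positivity
  simp_rw [sqrt_gaussianPDFReal_mul m n hs ht]
  rw [integral_const_mul, integral_sub_right_eq_self
      (fun x => Real.exp (-((s + t) / (4 * s * t) : ℝ) * x ^ 2)), integral_gaussian, mul_pow,
    mul_pow, Real.sq_sqrt (by positivity), Real.sq_sqrt (by positivity), h_exp, h_const,
    gaussianAffinitySq]
  field_simp
  rw [h_sqrt]
  ring

variable {ι : Type*} [Fintype ι] (m n : ι → ℝ) {s t : ι → ℝ≥0}

theorem prod_gaussianPDFReal_nonneg (m : ι → ℝ) (s : ι → ℝ≥0) (x : ι → ℝ) :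
    0 ≤ ∏ i, gaussianPDFReal (m i) (s i) (x i) :=
  Finset.prod_nonneg fun i _ => gaussianPDFReal_nonneg (m i) (s i) (x i)

theorem integrable_prod_gaussianPDFReal (m : ι → ℝ) (s : ι → ℝ≥0) :
    Integrable fun x : ι → ℝ => ∏ i, gaussianPDFReal (m i) (s i) (x i) :=
  Integrable.fintype_prod fun i => integrable_gaussianPDFReal (m i) (s i)

theorem integral_prod_gaussianPDFReal (hs : ∀ i, s i ≠ 0) :
    ∫ x : ι → ℝ, ∏ i, gaussianPDFReal (m i) (s i) (x i) = 1 := by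
  rw [integral_fintype_prod_volume_eq_prod (fun i => gaussianPDFReal (m i) (s i))]
  exact Finset.prod_eq_one fun i _ => integral_gaussianPDFReal_eq_one (m i) (hs i)

theorem pi_gaussianReal_eq_withDensity (hs : ∀ i, s i ≠ 0) :
    Measure.pi (fun i => gaussianReal (m i) (s i))
      = (volume : Measure (ι → ℝ)).withDensity
          (fun x => ENNReal.ofReal (∏ i, gaussianPDFReal (m i) (s i) (x i))) := by
  refine Measure.pi_eq fun A hA => ?_
  rw [withDensity_apply _ (MeasurableSet.univ_pi hA), volume_pi, Measure.restrict_pi_pi,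
    ← ofReal_integral_eq_lintegral_ofReal
      (Integrable.fintype_prod fun i => (integrable_gaussianPDFReal (m i) (s i)).restrict)
      (ae_of_all _ (prod_gaussianPDFReal_nonneg m s)),
    integral_fintype_prod_eq_prod, ENNReal.ofReal_prod_of_nonneg
      (fun i _ => integral_nonneg (gaussianPDFReal_nonneg (m i) (s i)))]
  refine Finset.prod_congr rfl fun i _ => ?_
  rw [gaussianReal_of_var_ne_zero _ (hs i), withDensity_apply _ (hA i)]
  exact ofReal_integral_eq_lintegral_ofReal (integrable_gaussianPDFReal (m i) (s i)).restrict
    (ae_of_all _ (gaussianPDFReal_nonneg (m i) (s i)))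

theorem pi_gaussianReal_real (hs : ∀ i, s i ≠ 0) {A : Set (ι → ℝ)} (hA : MeasurableSet A) :
    (Measure.pi (fun i => gaussianReal (m i) (s i))).real A
      = ∫ x in A, ∏ i, gaussianPDFReal (m i) (s i) (x i) := by
  rw [Measure.real, pi_gaussianReal_eq_withDensity m hs, withDensity_apply _ hA,
    ← ofReal_integral_eq_lintegral_ofReal (integrable_prod_gaussianPDFReal m s).restrict
      (ae_of_all _ (prod_gaussianPDFReal_nonneg m s)),
    ENNReal.toReal_ofReal (integral_nonneg (prod_gaussianPDFReal_nonneg m s))]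

theorem sq_integral_sqrt_prod_gaussianPDFReal_mul (hs : ∀ i, s i ≠ 0) (ht : ∀ i, t i ≠ 0) :
    (∫ x : ι → ℝ, √((∏ i, gaussianPDFReal (m i) (s i) (x i))
        * ∏ i, gaussianPDFReal (n i) (t i) (x i))) ^ 2
      = ∏ i, gaussianAffinitySq (m i) (s i) (n i) (t i) := by
  simp_rw [← Finset.prod_mul_distrib, Real.sqrt_prod _ fun i _ =>
    mul_nonneg (gaussianPDFReal_nonneg (m i) (s i) _) (gaussianPDFReal_nonneg (n i) (t i) _)]
  rw [integral_fintype_prod_volume_eq_prod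
    (fun i x => √(gaussianPDFReal (m i) (s i) x * gaussianPDFReal (n i) (t i) x)),
    ← Finset.prod_pow]
  simp_rw [sq_integral_sqrt_gaussianPDFReal_mul _ _ (hs _) (ht _)]

theorem sq_pi_gaussianReal_sub_le {A : Set (ι → ℝ)} (hA : MeasurableSet A) :
    ((Measure.pi (fun i => gaussianReal (m i) (s i))).real A
        - (Measure.pi (fun i => gaussianReal (n i) (t i))).real A) ^ 2
      ≤ ∑ i, (1 - gaussianAffinitySq (m i) (s i) (n i) (t i)) := by
  have h_nonneg (i : ι) := gaussianAffinitySq_nonneg (m i) (n i) (s i).2 (t i).2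
  have h_le_one (i : ι) := gaussianAffinitySq_le_one (m i) (n i) (s i).2 (t i).2
  by_cases h_degenerate : ∃ i, s i = 0 ∨ t i = 0
  · obtain ⟨i, hi⟩ := h_degenerate
    have h_zero : gaussianAffinitySq (m i) (s i) (n i) (t i) = 0 :=
      gaussianAffinitySq_eq_zero _ _ (by simpa using hi)
    calc _ ≤ (1 : ℝ) := sq_measureReal_sub_le_one
      _ = 1 - gaussianAffinitySq (m i) (s i) (n i) (t i) := by rw [h_zero, sub_zero]
      _ ≤ _ := Finset.single_le_sum (fun j _ => sub_nonneg.2 (h_le_one j)) (Finset.mem_univ i)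
  · push Not at h_degenerate
    have hs (i : ι) := (h_degenerate i).1
    have ht (i : ι) := (h_degenerate i).2
    rw [pi_gaussianReal_real m hs hA, pi_gaussianReal_real n ht hA]
    refine (sq_setIntegral_sub_le (integrable_prod_gaussianPDFReal m s)
      (integrable_prod_gaussianPDFReal n t) (prod_gaussianPDFReal_nonneg m s)
      (prod_gaussianPDFReal_nonneg n t) (integral_prod_gaussianPDFReal m hs)
      (integral_prod_gaussianPDFReal n ht) hA).trans ?_
    rw [sq_integral_sqrt_prod_gaussianPDFReal_mul m n hs ht]
    exact one_sub_prod_le_sum _ h_nonneg h_le_one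

end GaussianProducts

/-! ### Gaussian vectors with independent coordinates in an orthonormal basis -/

theorem pi_dirac {ι : Type*} [Fintype ι] {X : ι → Type*} [∀ i, MeasurableSpace (X i)]
    (a : ∀ i, X i) : Measure.pi (fun i => Measure.dirac (a i)) = Measure.dirac a := by
  classical
  refine Measure.pi_eq fun A hA => ?_
  rw [Measure.dirac_apply' _ (MeasurableSet.univ_pi hA)]
  simp_rw [Measure.dirac_apply' _ (hA _), Set.indicator_apply, Set.mem_univ_pi, Pi.one_apply]
  simp [Finset.prod_ite_zero]

section BasisGaussian

open scoped NNReal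

variable {ι E : Type*} [Fintype ι] [NormedAddCommGroup E] [InnerProductSpace ℝ E]
  [MeasurableSpace E] [BorelSpace E] (b : OrthonormalBasis ι ℝ E)

/-- The coordinates in an orthonormal basis, as a measurable equivalence with the plain product
`ι → ℝ`, where `Measure.pi` lives. -/
def coordEquiv : E ≃ᵐ (ι → ℝ) :=
  b.measurableEquiv.trans (MeasurableEquiv.toLp 2 (ι → ℝ)).symm

theorem coordEquiv_apply (x : E) (j : ι) : coordEquiv b x j = b.repr x j := rfl

/-- The law of a vector whose coordinates in the orthonormal basis `b` are independent Gaussian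
variables with means `m j` and variances `s j`. -/
def basisGaussian (m : ι → ℝ) (s : ι → ℝ≥0) : Measure E :=
  (Measure.pi fun j => gaussianReal (m j) (s j)).map (coordEquiv b).symm

instance isProbabilityMeasure_basisGaussian (m : ι → ℝ) (s : ι → ℝ≥0) :
    IsProbabilityMeasure (basisGaussian b m s) :=
  Measure.isProbabilityMeasure_map (MeasurableEquiv.measurable _).aemeasurable

theorem dirac_eq_basisGaussian (x : E) : Measure.dirac x = basisGaussian b (coordEquiv b x) 0 := by
  simp only [basisGaussian, Pi.zero_apply, gaussianReal_zero_var, pi_dirac]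
  rw [Measure.map_dirac' (MeasurableEquiv.measurable _), MeasurableEquiv.symm_apply_apply]

theorem sq_basisGaussian_sub_le (m n : ι → ℝ) (s t : ι → ℝ≥0) {A : Set E}
    (hA : MeasurableSet A) :
    ((basisGaussian b m s).real A - (basisGaussian b n t).real A) ^ 2
      ≤ ∑ j, (1 - gaussianAffinitySq (m j) (s j) (n j) (t j)) := by
  have h_meas := (coordEquiv b).symm.measurable
  rw [basisGaussian, basisGaussian, map_measureReal_apply h_meas hA,
    map_measureReal_apply h_meas hA]
  exact sq_pi_gaussianReal_sub_le m n (h_meas hA)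

theorem map_add_mul_gaussianReal_prod (m n : ℝ) (s t : ℝ≥0) (c c' : ℝ) :
    ((gaussianReal m s).prod (gaussianReal n t)).map (fun p => c * p.1 + c' * p.2)
      = gaussianReal (c * m + c' * n) (Real.toNNReal (c ^ 2 * s + c' ^ 2 * t)) := by
  have h_factor : (fun p : ℝ × ℝ => c * p.1 + c' * p.2)
      = (fun p : ℝ × ℝ => p.1 + p.2) ∘ Prod.map (fun x => c * x) (fun x => c' * x) := rfl
  rw [h_factor, ← Measure.map_map (by fun_prop) (by fun_prop),
    ← Measure.map_prod_map _ _ (by fun_prop) (by fun_prop), gaussianReal_map_const_mul,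
    gaussianReal_map_const_mul]
  refine gaussianReal_conv_gaussianReal.trans ?_
  congr 1
  ext
  rw [Real.coe_toNNReal _ (by positivity)]
  simp

theorem map_basisGaussian_prod (m n : ι → ℝ) (s t : ι → ℝ≥0) (c c' : ι → ℝ) {F : E × E → E}
    (hF : Measurable F)
    (hFc : ∀ z j, coordEquiv b (F z) j = c j * coordEquiv b z.1 j + c' j * coordEquiv b z.2 j) :
    ((basisGaussian b m s).prod (basisGaussian b n t)).map F
      = basisGaussian b (fun j => c j * m j + c' j * n j)
          (fun j => Real.toNNReal (c j ^ 2 * s j + c' j ^ 2 * t j)) := by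
  have h_meas := (coordEquiv b).symm.measurable
  rw [basisGaussian, basisGaussian, Measure.map_prod_map _ _ h_meas h_meas,
    Measure.map_map hF (by fun_prop),
    ← (measurePreserving_arrowProdEquivProdArrow ℝ ℝ ι (fun j => gaussianReal (m j) (s j))
      (fun j => gaussianReal (n j) (t j))).map_eq,
    Measure.map_map (by fun_prop) (MeasurableEquiv.measurable _), basisGaussian]
  simp_rw [← map_add_mul_gaussianReal_prod]
  rw [← Measure.pi_map_pi (fun i => by fun_prop), Measure.map_map h_meas (by fun_prop)]
  congr 1
  funext y
  refine ((coordEquiv b).eq_symm_apply).2 ?_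
  funext j
  refine (hFc _ j).trans ?_
  simp [MeasurableEquiv.arrowProdEquivProdArrow, Equiv.arrowProdEquivProdArrow]

variable [FiniteDimensional ℝ E]

theorem measurePreserving_coordEquiv : MeasurePreserving (coordEquiv b) :=
  (PiLp.volume_preserving_ofLp ι).comp b.measurePreserving_repr

theorem stdGaussian_eq_basisGaussian : stdGaussian E = basisGaussian b 0 1 := by
  rw [stdGaussian_eq_map_pi_orthonormalBasis b, basisGaussian]
  congr 1
  funext y
  exact b.sum_repr_symm (WithLp.toLp 2 y)

theorem basisGaussian_eq_withDensity (m : ι → ℝ) {s : ι → ℝ≥0} (hs : ∀ j, s j ≠ 0) :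
    basisGaussian b m s = volume.withDensity
      fun x => ENNReal.ofReal (∏ j, gaussianPDFReal (m j) (s j) (coordEquiv b x j)) := by
  ext A hA
  rw [basisGaussian, MeasurableEquiv.map_apply, pi_gaussianReal_eq_withDensity m hs,
    withDensity_apply _ ((coordEquiv b).symm.measurable hA), withDensity_apply _ hA,
    ← (measurePreserving_coordEquiv b).setLIntegral_comp_preimage_emb
      (coordEquiv b).measurableEmbedding, ← Set.preimage_comp, MeasurableEquiv.symm_comp_self,
    Set.preimage_id]

theorem integral_prod_gaussianPDFReal_coordEquiv (m : ι → ℝ) {s : ι → ℝ≥0} (hs : ∀ j, s j ≠ 0) :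
    ∫ x, ∏ j, gaussianPDFReal (m j) (s j) (coordEquiv b x j) = 1 := by
  rw [(measurePreserving_coordEquiv b).integral_comp (coordEquiv b).measurableEmbedding
    fun y => ∏ j, gaussianPDFReal (m j) (s j) (y j)]
  exact integral_prod_gaussianPDFReal m hs

end BasisGaussian

/-! ### Quadratic potentials in eigencoordinates -/

section QuadraticPotential

open Matrix

theorem isHermitian_of_posSemidef_sub_smul_one {n : Type*} [DecidableEq n]
    {B : Matrix n n ℝ} {α : ℝ} (h : (B - α • (1 : Matrix n n ℝ)).PosSemidef) : B.IsHermitian := by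
  have h_add := h.isHermitian.add (Matrix.isHermitian_one.smul (IsSelfAdjoint.all α))
  rwa [sub_add_cancel] at h_add

theorem eigenvectorBasis_dotProduct_mulVec {n : Type*} [Fintype n] [DecidableEq n]
    {B : Matrix n n ℝ} (hB : B.IsHermitian) (c : ℝ) (j : n) :
    (hB.eigenvectorBasis j).ofLp ⬝ᵥ ((B - c • (1 : Matrix n n ℝ)) *ᵥ (hB.eigenvectorBasis j).ofLp)
      = hB.eigenvalues j - c := by
  have h_unit : (hB.eigenvectorBasis j).ofLp ⬝ᵥ (hB.eigenvectorBasis j).ofLp = 1 := by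
    have h := real_inner_self_eq_norm_sq (hB.eigenvectorBasis j)
    rw [hB.eigenvectorBasis.orthonormal.1 j, EuclideanSpace.inner_eq_star_dotProduct] at h
    simpa using h
  rw [sub_mulVec, hB.mulVec_eigenvectorBasis, smul_mulVec, one_mulVec, ← sub_smul,
    dotProduct_smul, h_unit, smul_eq_mul, mul_one]

theorem le_eigenvalues_of_posSemidef_sub {n : Type*} [Fintype n] [DecidableEq n]
    {B : Matrix n n ℝ} (hB : B.IsHermitian) {α : ℝ}
    (h : (B - α • (1 : Matrix n n ℝ)).PosSemidef) (j : n) : α ≤ hB.eigenvalues j := by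
  have h_nonneg := h.dotProduct_mulVec_nonneg (hB.eigenvectorBasis j).ofLp
  rw [star_trivial, eigenvectorBasis_dotProduct_mulVec] at h_nonneg
  exact sub_nonneg.1 h_nonneg

theorem eigenvalues_le_of_posSemidef_sub {n : Type*} [Fintype n] [DecidableEq n]
    {B : Matrix n n ℝ} (hB : B.IsHermitian) {β : ℝ}
    (h : (β • (1 : Matrix n n ℝ) - B).PosSemidef) (j : n) : hB.eigenvalues j ≤ β := by
  have h_nonneg := h.dotProduct_mulVec_nonneg (hB.eigenvectorBasis j).ofLp
  rw [star_trivial, ← neg_sub, neg_mulVec, dotProduct_neg,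
    eigenvectorBasis_dotProduct_mulVec, neg_sub] at h_nonneg
  exact sub_nonneg.1 h_nonneg

variable {d : ℕ} {B : Matrix (Fin d) (Fin d) ℝ} (hB : B.IsHermitian)

include hB in
theorem gradient_potential :
    gradient (potential B) = fun x => Matrix.toEuclideanCLM (𝕜 := ℝ) B x := by
  funext x
  have h_symm : (Matrix.toEuclideanCLM (𝕜 := ℝ) B : Vec d →ₗ[ℝ] Vec d).IsSymmetric :=
    isSymmetric_toEuclideanLin_iff.2 hB
  have h_quadratic : potential B = fun x => (1 / 2 : ℝ) *
      (Matrix.toEuclideanCLM (𝕜 := ℝ) B).reApplyInnerSelf x := by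
    funext y
    simp [potential, ContinuousLinearMap.reApplyInnerSelf_apply,
      EuclideanSpace.inner_eq_star_dotProduct]
  refine HasGradientAt.gradient ?_
  rw [hasGradientAt_iff_hasFDerivAt, h_quadratic]
  convert! (h_symm.hasStrictFDerivAt_reApplyInnerSelf x).hasFDerivAt.const_mul (1 / 2 : ℝ) using 1
  ext y
  simp

include hB in
theorem measurable_gradient_potential : Measurable (gradient (potential B)) := by
  rw [gradient_potential hB]
  fun_prop

theorem coordEquiv_gradient_potential (x : Vec d) (j : Fin d) :
    coordEquiv hB.eigenvectorBasis (gradient (potential B) x) j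
      = hB.eigenvalues j * coordEquiv hB.eigenvectorBasis x j := by
  have h_symm : (Matrix.toEuclideanCLM (𝕜 := ℝ) B : Vec d →ₗ[ℝ] Vec d).IsSymmetric :=
    isSymmetric_toEuclideanLin_iff.2 hB
  have h_eigen : Matrix.toEuclideanCLM (𝕜 := ℝ) B (hB.eigenvectorBasis j)
      = hB.eigenvalues j • hB.eigenvectorBasis j := by
    ext i
    simpa using congrFun (hB.mulVec_eigenvectorBasis j) i
  rw [gradient_potential hB, coordEquiv_apply, coordEquiv_apply,
    OrthonormalBasis.repr_apply_apply, OrthonormalBasis.repr_apply_apply]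
  refine (h_symm (hB.eigenvectorBasis j) x).symm.trans ?_
  rw [ContinuousLinearMap.coe_coe, h_eigen, real_inner_smul_left]

theorem potential_eq_sum_eigenvalues (x : Vec d) :
    potential B x = ∑ j, hB.eigenvalues j * coordEquiv hB.eigenvectorBasis x j ^ 2 / 2 := by
  have h_inner : potential B x = 1 / 2 * inner ℝ (gradient (potential B) x) x := by
    rw [gradient_potential hB]
    simp [potential, EuclideanSpace.inner_eq_star_dotProduct]
  rw [h_inner, ← hB.eigenvectorBasis.repr.inner_map_map, PiLp.inner_apply, Finset.mul_sum]
  refine Finset.sum_congr rfl fun j _ => ?_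
  simp only [← coordEquiv_apply, coordEquiv_gradient_potential, RCLike.inner_apply, conj_trivial]
  ring

end QuadraticPotential

theorem exp_neg_mul_sq_eq_mul_gaussianPDFReal {l : ℝ} (hl : 0 < l) (y : ℝ) :
    Real.exp (-(l * y ^ 2 / 2))
      = √(2 * Real.pi * l⁻¹) * gaussianPDFReal 0 (Real.toNNReal l⁻¹) y := by
  have := Real.pi_pos
  rw [gaussianPDFReal, Real.coe_toNNReal _ (inv_pos.2 hl).le, mul_inv_cancel_left₀ (by positivity)]
  congr 1
  field_simp
  ring

theorem target_eq_basisGaussian {d : ℕ} {B : Matrix (Fin d) (Fin d) ℝ} (hB : B.IsHermitian)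
    (hpos : ∀ j, 0 < hB.eigenvalues j) :
    target B = basisGaussian hB.eigenvectorBasis 0
      (fun j => Real.toNNReal (hB.eigenvalues j)⁻¹) := by
  have h_var (j : Fin d) : Real.toNNReal (hB.eigenvalues j)⁻¹ ≠ 0 :=
    (Real.toNNReal_pos.2 (inv_pos.2 (hpos j))).ne'
  set c : ℝ := ∏ j, √(2 * Real.pi * (hB.eigenvalues j)⁻¹)
  have hc : c ≠ 0 := Finset.prod_ne_zero_iff.2 fun j _ => by
    have := Real.pi_pos
    have := hpos j
    positivity
  have h_exp (x : Vec d) : Real.exp (-potential B x)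
      = c * ∏ j, gaussianPDFReal 0 (Real.toNNReal (hB.eigenvalues j)⁻¹)
          (coordEquiv hB.eigenvectorBasis x j) := by
    rw [potential_eq_sum_eigenvalues hB, ← Finset.sum_neg_distrib, Real.exp_sum,
      ← Finset.prod_mul_distrib]
    exact Finset.prod_congr rfl fun j _ => exp_neg_mul_sq_eq_mul_gaussianPDFReal (hpos j) _
  have h_partition : ∫ x, Real.exp (-potential B x) = c := by
    simp_rw [h_exp]
    rw [integral_const_mul]
    exact (congrArg (c * ·) (integral_prod_gaussianPDFReal_coordEquiv _ 0 h_var)).trans (mul_one c)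
  rw [basisGaussian_eq_withDensity _ _ h_var, target, Measure.tilted, h_partition]
  simp_rw [h_exp, mul_div_cancel_left₀ _ hc]
  rfl

/-! ### Leapfrog integration of a linear oscillator -/

section Leapfrog

/-- The angle by which a leapfrog step of size `δ` rotates the (rescaled) phase space of an
oscillator of squared frequency `l`. -/
def leapfrogAngle (δ l : ℝ) : ℝ := Real.arccos (1 - δ ^ 2 * l / 2)

variable {δ l : ℝ}

theorem cos_leapfrogAngle (h0 : 0 ≤ l) (h1 : δ ^ 2 * l ≤ 4) :
    Real.cos (leapfrogAngle δ l) = 1 - δ ^ 2 * l / 2 :=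
  Real.cos_arccos (by linarith) (by linarith [mul_nonneg (sq_nonneg δ) h0])

theorem sin_leapfrogAngle_sq (h0 : 0 ≤ l) (h1 : δ ^ 2 * l ≤ 4) :
    Real.sin (leapfrogAngle δ l) ^ 2 = δ ^ 2 * l * (1 - δ ^ 2 * l / 4) := by
  rw [Real.sin_sq, cos_leapfrogAngle h0 h1]
  ring

theorem sin_leapfrogAngle_pos (hδ : δ ≠ 0) (h0 : 0 < l) (h1 : δ ^ 2 * l < 4) :
    0 < Real.sin (leapfrogAngle δ l) := by
  refine lt_of_le_of_ne (Real.sin_nonneg_of_nonneg_of_le_pi (Real.arccos_nonneg _)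
    (Real.arccos_le_pi _)) fun h => ?_
  have h_sq := sin_leapfrogAngle_sq h0.le h1.le
  have : 0 < δ ^ 2 * l * (1 - δ ^ 2 * l / 4) := mul_pos (by positivity) (by linarith)
  rw [← h_sq, ← h] at this
  simp at this

variable {d : ℕ} {g : Vec d → Vec d} {ℓ : Vec d →ₗ[ℝ] ℝ}

theorem linearMap_leapfrogStep_fst (hℓ : ∀ x, ℓ (g x) = l * ℓ x) (z : Vec d × Vec d) :
    ℓ (leapfrogStep g δ z).1 = (1 - δ ^ 2 * l / 2) * ℓ z.1 + δ * ℓ z.2 := by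
  simp only [leapfrogStep, map_add, map_sub, map_smul, smul_eq_mul, hℓ]
  ring

theorem linearMap_leapfrogStep_snd (hℓ : ∀ x, ℓ (g x) = l * ℓ x) (z : Vec d × Vec d) :
    ℓ (leapfrogStep g δ z).2
      = (1 - δ ^ 2 * l / 2) * ℓ z.2 - δ * l * (1 - δ ^ 2 * l / 4) * ℓ z.1 := by
  simp only [leapfrogStep, map_add, map_sub, map_smul, smul_eq_mul, hℓ]
  ring

theorem linearMap_leapfrog (hℓ : ∀ x, ℓ (g x) = l * ℓ x) (hδ : δ ≠ 0) (h0 : 0 < l)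
    (h1 : δ ^ 2 * l < 4) (z : Vec d × Vec d) (k : ℕ) :
    ℓ (leapfrog g δ k z).1 = Real.cos (k * leapfrogAngle δ l) * ℓ z.1
        + δ / Real.sin (leapfrogAngle δ l) * Real.sin (k * leapfrogAngle δ l) * ℓ z.2 ∧
      ℓ (leapfrog g δ k z).2 = Real.cos (k * leapfrogAngle δ l) * ℓ z.2
        - Real.sin (leapfrogAngle δ l) / δ * Real.sin (k * leapfrogAngle δ l) * ℓ z.1 := by
  have h_cos := cos_leapfrogAngle h0.le h1.le
  have h_sin := (sin_leapfrogAngle_pos hδ h0 h1).ne'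
  have h_sin_sq : δ * l * (1 - δ ^ 2 * l / 4) = Real.sin (leapfrogAngle δ l) ^ 2 / δ := by
    rw [sin_leapfrogAngle_sq h0.le h1.le]
    field_simp
  induction k with
  | zero => simp [leapfrog]
  | succ k ih =>
    have h_iterate : leapfrog g δ (k + 1) z = leapfrogStep g δ (leapfrog g δ k z) :=
      Function.iterate_succ_apply' _ _ _
    rw [h_iterate, linearMap_leapfrogStep_fst hℓ, linearMap_leapfrogStep_snd hℓ, ih.1, ih.2,
      h_sin_sq, ← h_cos]
    push_cast
    rw [add_mul, one_mul, Real.cos_add, Real.sin_add]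
    constructor <;> field_simp <;> ring

end Leapfrog

/-! ### The chain conditioned on its integration times -/

theorem map_prod_eq_bind {X Y Ω : Type*} [MeasurableSpace X] [MeasurableSpace Y]
    [DiscreteMeasurableSpace Y] [MeasurableSpace Ω] (μ : Measure X) (ν : Measure Y) [SFinite μ]
    [SFinite ν] {F : X × Y → Ω} (hF : Measurable F) :
    (μ.prod ν).map F = ν.bind fun y => μ.map fun x => F (x, y) := by
  ext A hA
  rw [Measure.map_apply hF hA, Measure.prod_apply_symm (hF hA),
    Measure.bind_apply hA Measurable.of_discrete.aemeasurable]
  exact lintegral_congr fun y => (Measure.map_apply (hF.comp measurable_prodMk_right) hA).symm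

theorem bind_uniformOn_real {Y Ω : Type*} [MeasurableSpace Y] [DiscreteMeasurableSpace Y]
    [MeasurableSpace Ω] (s : Finset Y) (f : Y → Measure Ω) [∀ y, IsFiniteMeasure (f y)] {A : Set Ω}
    (hA : MeasurableSet A) :
    ((uniformOn (s : Set Y)).bind f).real A = (∑ y ∈ s, (f y).real A) / s.card := by
  rw [measureReal_def, Measure.bind_apply hA Measurable.of_discrete.aemeasurable, uniformOn,
    ProbabilityTheory.cond, lintegral_smul_measure, lintegral_finset, Measure.count_apply_finset,
    smul_eq_mul, ENNReal.toReal_mul, ENNReal.toReal_inv, ENNReal.toReal_natCast, div_eq_inv_mul]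
  simp only [Measure.count_singleton, mul_one]
  rw [ENNReal.toReal_sum fun y _ => measure_ne_top _ _]
  rfl

section ConditionalLaw

variable {ι E : Type*} [Fintype ι] [NormedAddCommGroup E] [InnerProductSpace ℝ E]
  [MeasurableSpace E] [BorelSpace E] (b : OrthonormalBasis ι ℝ E) (y τ R : ι → ℝ)

/-- The law of the chain given its integration times: `y` are the coordinates of the starting
point, `τ` the variances in stationarity, and `R` the products of the cosines of the angles
by which the phase space has been rotated so far. As `R` decreases from `1` to `0`, this
interpolates between a Dirac mass and the stationary law. -/
def conditionalLaw : Measure E :=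
  basisGaussian b (fun j => R j * y j) (fun j => Real.toNNReal ((1 - R j ^ 2) * τ j))

instance isProbabilityMeasure_conditionalLaw : IsProbabilityMeasure (conditionalLaw b y τ R) :=
  inferInstanceAs (IsProbabilityMeasure (basisGaussian _ _ _))

theorem conditionalLaw_one (x : E) : conditionalLaw b (coordEquiv b x) τ 1 = Measure.dirac x := by
  rw [dirac_eq_basisGaussian b x, conditionalLaw]
  congr 1
  · simp
  · funext j
    simp

variable {y τ R}

theorem map_conditionalLaw_prod_stdGaussian [FiniteDimensional ℝ E] {a θ : ι → ℝ}
    (hR : ∀ j, |R j| ≤ 1) {F : E × E → E} (hF : Measurable F)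
    (hFc : ∀ z j, coordEquiv b (F z) j
      = Real.cos (θ j) * coordEquiv b z.1 j + a j * Real.sin (θ j) * coordEquiv b z.2 j) :
    ((conditionalLaw b y (fun j => a j ^ 2) R).prod (stdGaussian E)).map F
      = conditionalLaw b y (fun j => a j ^ 2) (fun j => Real.cos (θ j) * R j) := by
  rw [stdGaussian_eq_basisGaussian b, conditionalLaw, map_basisGaussian_prod b _ _ _ _ _ _ hF hFc,
    conditionalLaw]
  congr 1 <;> funext j
  · simp only [Pi.zero_apply]
    ring
  · rw [Real.coe_toNNReal _ (mul_nonneg (sub_nonneg.2 ((sq_le_one_iff_abs_le_one _).2 (hR j)))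
      (sq_nonneg _))]
    congr 1
    rw [mul_pow _ (Real.sin _), Real.sin_sq]
    simp only [Pi.one_apply, NNReal.coe_one]
    ring

end ConditionalLaw

section HMCKernel

variable {d : ℕ} {B : Matrix (Fin d) (Fin d) ℝ} (hB : B.IsHermitian) {α δ : ℝ}

include hB in
theorem isMarkovKernel_hmcKernel (hα : 0 < α) (hδ : 0 < δ) :
    IsMarkovKernel (hmcKernel B α δ) :=
  have := isProbabilityMeasure_drawLaw d hα hδ
  isMarkovKernel_randomMapKernel (measurable_hmcStep δ (measurable_gradient_potential hB))

theorem coordEquiv_hmcStep (hδ : δ ≠ 0) {j : Fin d} (h0 : 0 < hB.eigenvalues j)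
    (h1 : δ ^ 2 * hB.eigenvalues j < 4) (x v : Vec d) (k : ℕ) :
    coordEquiv hB.eigenvectorBasis (hmcStep (gradient (potential B)) δ (x, v, k)) j
      = Real.cos (k * leapfrogAngle δ (hB.eigenvalues j)) * coordEquiv hB.eigenvectorBasis x j
        + δ / Real.sin (leapfrogAngle δ (hB.eigenvalues j))
          * Real.sin (k * leapfrogAngle δ (hB.eigenvalues j))
          * coordEquiv hB.eigenvectorBasis v j :=
  (linearMap_leapfrog (ℓ := hB.eigenvectorBasis.toBasis.coord j)
    (fun x => coordEquiv_gradient_potential hB x j) hδ h0 h1 (x, v) k).1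

theorem bind_conditionalLaw_hmcKernel (hα : 0 < α) (hδ : 0 < δ) (h0 : ∀ j, 0 < hB.eigenvalues j)
    (h1 : ∀ j, δ ^ 2 * hB.eigenvalues j < 4) (y : Fin d → ℝ) {R : Fin d → ℝ}
    (hR : ∀ j, |R j| ≤ 1) :
    let L := conditionalLaw hB.eigenvectorBasis y
      fun j => (δ / Real.sin (leapfrogAngle δ (hB.eigenvalues j))) ^ 2
    (L R).bind (hmcKernel B α δ) = (uniformOn (stepCounts α δ)).bind fun k =>
      L fun j => Real.cos (k * leapfrogAngle δ (hB.eigenvalues j)) * R j := by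
  intro L
  have := isProbabilityMeasure_uniformOn_stepCounts hα hδ
  have := isProbabilityMeasure_drawLaw d hα hδ
  have h_step := measurable_hmcStep δ (measurable_gradient_potential hB)
  refine (bind_randomMapKernel (ν := drawLaw d α δ) h_step _).trans ?_
  rw [drawLaw, ← Measure.prodAssoc_prod, Measure.map_map h_step (MeasurableEquiv.measurable _),
    map_prod_eq_bind _ _ (h_step.comp (MeasurableEquiv.measurable _))]
  congr 1
  funext k
  exact map_conditionalLaw_prod_stdGaussian _ hR (h_step.comp (by fun_prop))
    fun z j => coordEquiv_hmcStep hB hδ.ne' (h0 j) (h1 j) z.1 z.2 k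

end HMCKernel

/-! ### Contraction by averaging -/

theorem sq_le_of_eq_average {ι κ : Type*} [Fintype ι] {s : Finset κ} (hs : s.Nonempty)
    {c : κ → ι → ℝ} (hc : ∀ k j, |c k j| ≤ 1) {ρ : ℝ} (hρ0 : 0 ≤ ρ)
    (hρ : ∀ j, (∑ k ∈ s, c k j ^ 2) / s.card ≤ ρ) {φ : ℕ → (ι → ℝ) → ℝ}
    (h_succ : ∀ K R, (∀ j, |R j| ≤ 1) →
      φ (K + 1) R = (∑ k ∈ s, φ K fun j => c k j * R j) / s.card)
    {u : ℝ} {w : ι → ℝ} (hw : ∀ j, 0 ≤ w j)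
    (h_zero : ∀ R, (∀ j, |R j| ≤ 1) → φ 0 R ^ 2 ≤ u + ∑ j, w j * R j ^ 2)
    (K : ℕ) {R : ι → ℝ} (hR : ∀ j, |R j| ≤ 1) :
    φ K R ^ 2 ≤ u + ρ ^ K * ∑ j, w j * R j ^ 2 := by
  have h_card : (s.card : ℝ) ≠ 0 := by exact_mod_cast hs.card_ne_zero
  induction K generalizing R with
  | zero => simpa using h_zero R hR
  | succ K ih =>
    have hcR (k : κ) (j : ι) : |c k j * R j| ≤ 1 := by
      rw [abs_mul]
      exact mul_le_one₀ (hc k j) (abs_nonneg _) (hR j)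
    calc φ (K + 1) R ^ 2
        ≤ (∑ k ∈ s, φ K (fun j => c k j * R j) ^ 2) / s.card := by
          rw [h_succ K R hR]
          exact sum_div_card_sq_le_sum_sq_div_card
      _ ≤ (∑ k ∈ s, (u + ρ ^ K * ∑ j, w j * (c k j * R j) ^ 2)) / s.card := by
          gcongr with k
          exact ih (hcR k)
      _ = u + ρ ^ K * ∑ j, w j * R j ^ 2 * ((∑ k ∈ s, c k j ^ 2) / s.card) := by
          rw [Finset.sum_add_distrib, Finset.sum_const, nsmul_eq_mul, add_div,
            mul_div_cancel_left₀ _ h_card, ← Finset.mul_sum, Finset.sum_comm, mul_div_assoc,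
            Finset.sum_div]
          simp only [mul_pow, mul_div_assoc', Finset.mul_sum, mul_assoc, mul_comm (c _ _ ^ 2)]
      _ ≤ u + ρ ^ K * ∑ j, w j * R j ^ 2 * ρ := by
          gcongr with j
          · exact mul_nonneg (hw j) (sq_nonneg _)
          · exact hρ j
      _ = u + ρ ^ (K + 1) * ∑ j, w j * R j ^ 2 := by
          rw [← Finset.sum_mul, pow_succ, mul_assoc, mul_comm ρ]

theorem sum_cos_sq_le {θ : ℝ} (hθ : 0 < Real.sin θ) (N : ℕ) :
    ∑ k ∈ Finset.range N, Real.cos (k * θ) ^ 2 ≤ N / 2 + 1 / (2 * Real.sin θ) := by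
  have h_double : ∑ k ∈ Finset.range N, Real.cos (k * θ) ^ 2
      = N / 2 + (∑ k ∈ Finset.range N, Real.cos (2 * (k * θ))) / 2 := by
    simp_rw [Real.cos_sq]
    rw [Finset.sum_add_distrib, Finset.sum_div, Finset.sum_const, Finset.card_range,
      nsmul_eq_mul]
    ring
  have h_oscillation : ∑ k ∈ Finset.range N, Real.cos (2 * (k * θ)) ≤ 1 / Real.sin θ := by
    rw [le_div_iff₀ hθ]
    calc (∑ k ∈ Finset.range N, Real.cos (2 * (k * θ))) * Real.sin θ
        = Real.sin (2 * θ / 2) * ∑ k ∈ Finset.range N, Real.cos (2 * θ * k + 0) := by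
          rw [mul_comm, mul_div_cancel_left₀ θ two_ne_zero]
          simp only [add_zero, mul_assoc, mul_comm θ]
      _ = Real.sin (N * (2 * θ) / 2) * Real.cos ((N - 1) * (2 * θ) / 2 + 0) :=
          Real.sin_mul_sum_cos N (2 * θ) 0
      _ ≤ 1 := (le_abs_self _).trans <| (abs_mul _ _).trans_le <|
          mul_le_one₀ (Real.abs_sin_le_one _) (abs_nonneg _) (Real.abs_cos_le_one _)
  have h_half : 1 / (2 * Real.sin θ) = 1 / Real.sin θ / 2 := by field_simp
  rw [h_double, h_half]
  linarith

theorem average_cos_sq_le {θ : ℝ} (hθ : 0 < Real.sin θ) {N : ℕ} (hN : 2 ≤ N * Real.sin θ) :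
    (∑ k ∈ Finset.range N, Real.cos (k * θ) ^ 2) / N ≤ 3 / 4 := by
  have hN0 : (0 : ℝ) < N := pos_of_mul_pos_left (by linarith) hθ.le
  rw [div_le_iff₀ hN0]
  have h_tail : 1 / (2 * Real.sin θ) ≤ N / 4 := by
    rw [div_le_iff₀ (by positivity)]
    linarith
  linarith [sum_cos_sq_le hθ N]

theorem mul_sqrt_div_two_le_sin_leapfrogAngle {α l δ : ℝ} (hα : 0 ≤ α) (hl : α ≤ l) (hl0 : 0 < l)
    (hδ : 0 < δ) (h1 : δ ^ 2 * l ≤ 3) : δ * √α / 2 ≤ Real.sin (leapfrogAngle δ l) := by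
  have h_pos := sin_leapfrogAngle_pos hδ.ne' hl0 (by linarith)
  refine (sq_le_sq₀ (by positivity) h_pos.le).1 ?_
  rw [sin_leapfrogAngle_sq hl0.le (by linarith), div_pow, mul_pow, Real.sq_sqrt hα]
  nlinarith [mul_le_mul_of_nonneg_left hl (sq_nonneg δ), mul_nonneg (sq_nonneg δ) hl0.le]

theorem average_cos_leapfrogAngle_sq_le {α l δ : ℝ} (hα : 0 < α) (hl : α ≤ l) (hδ : 0 < δ)
    (h1 : δ ^ 2 * l ≤ 3) {N : ℕ} (hN : 10 * Real.pi / √α / δ ≤ N) :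
    (∑ k ∈ Finset.range N, Real.cos (k * leapfrogAngle δ l) ^ 2) / N ≤ 3 / 4 := by
  have hl0 := hα.trans_le hl
  refine average_cos_sq_le (sin_leapfrogAngle_pos hδ.ne' hl0 (by linarith)) ?_
  calc (2 : ℝ) ≤ 10 * Real.pi / √α / δ * (δ * √α / 2) := by
        field_simp
        linarith [Real.pi_gt_three]
    _ ≤ N * Real.sin (leapfrogAngle δ l) := by
        gcongr
        exact mul_sqrt_div_two_le_sin_leapfrogAngle hα.le hl hl0 hδ h1

/-! ### Distance to the target -/

theorem sq_one_sub_div_le {u ρ : ℝ} (hu0 : 0 ≤ u) (hu : u ≤ 1 / 16) (h0 : 0 ≤ ρ) (h1 : ρ ≤ 1) :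
    (1 - (1 - ρ) / (1 - u)) ^ 2 ≤ 8 / 7 * (u ^ 2 + ρ) := by
  have h_pos : 0 < 1 - u := by linarith
  have h_sub : 1 - (1 - ρ) / (1 - u) = (ρ - u) / (1 - u) := by
    field_simp
    ring
  rw [h_sub, div_pow, div_le_iff₀ (by positivity)]
  have h_num : (ρ - u) ^ 2 ≤ u ^ 2 + ρ := by nlinarith
  have h_den : 7 / 8 ≤ (1 - u) ^ 2 := by nlinarith
  nlinarith [sq_nonneg u, h_den]

section DistanceToTarget

variable {d : ℕ} {B : Matrix (Fin d) (Fin d) ℝ} (hB : B.IsHermitian) {α δ : ℝ}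

theorem sq_conditionalLaw_sub_target_le (hδ : δ ≠ 0) (h0 : ∀ j, 0 < hB.eigenvalues j)
    (h1 : ∀ j, δ ^ 2 * hB.eigenvalues j ≤ 1 / 4) (y : Fin d → ℝ) {R : Fin d → ℝ}
    (hR : ∀ j, |R j| ≤ 1) {A : Set (Vec d)} (hA : MeasurableSet A) :
    ((conditionalLaw hB.eigenvectorBasis y
          (fun j => (δ / Real.sin (leapfrogAngle δ (hB.eigenvalues j))) ^ 2) R).real A
        - (target B).real A) ^ 2
      ≤ ∑ j, 8 / 7 * (δ ^ 2 * hB.eigenvalues j / 4) ^ 2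
        + ∑ j, (8 / 7 + hB.eigenvalues j * y j ^ 2 / 2) * R j ^ 2 := by
  rw [target_eq_basisGaussian hB h0, conditionalLaw, ← Finset.sum_add_distrib]
  refine (sq_basisGaussian_sub_le _ _ _ _ _ hA).trans (Finset.sum_le_sum fun j _ => ?_)
  have hR2 : R j ^ 2 ≤ 1 := (sq_le_one_iff_abs_le_one _).2 (hR j)
  have h_inv_pos := inv_pos.2 (h0 j)
  have h_var := mul_nonneg (sub_nonneg.2 hR2)
    (sq_nonneg (δ / Real.sin (leapfrogAngle δ (hB.eigenvalues j))))
  have hu : 0 ≤ δ ^ 2 * hB.eigenvalues j / 4 := by have := h0 j; positivity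
  rw [Real.coe_toNNReal _ h_var, Real.coe_toNNReal _ h_inv_pos.le]
  refine (one_sub_gaussianAffinitySq_le _ _ h_var h_inv_pos).trans ?_
  have h_ratio : (1 - R j ^ 2) * (δ / Real.sin (leapfrogAngle δ (hB.eigenvalues j))) ^ 2
        / (hB.eigenvalues j)⁻¹ = (1 - R j ^ 2) / (1 - δ ^ 2 * hB.eigenvalues j / 4) := by
    have : 1 - δ ^ 2 * hB.eigenvalues j / 4 ≠ 0 := by linarith [h1 j]
    rw [div_pow, sin_leapfrogAngle_sq (h0 j).le (by linarith [h1 j])]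
    have := (h0 j).ne'
    field_simp
  have h_scale := sq_one_sub_div_le hu (by linarith [h1 j]) (sq_nonneg (R j)) hR2
  have h_shift : (R j * y j - (0 : Fin d → ℝ) j) ^ 2 / (2 * (hB.eigenvalues j)⁻¹)
      = hB.eigenvalues j * y j ^ 2 / 2 * R j ^ 2 := by
    have := (h0 j).ne'
    rw [Pi.zero_apply]
    field_simp
    ring
  rw [h_ratio, h_shift]
  linarith

theorem bind_hmcKernel_pow_succ_real (hα : 0 < α) (hδ : 0 < δ) (h0 : ∀ j, 0 < hB.eigenvalues j)
    (h1 : ∀ j, δ ^ 2 * hB.eigenvalues j < 4) (y : Fin d → ℝ) {R : Fin d → ℝ}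
    (hR : ∀ j, |R j| ≤ 1) (K : ℕ) {A : Set (Vec d)} (hA : MeasurableSet A) :
    let L := conditionalLaw hB.eigenvectorBasis y
      fun j => (δ / Real.sin (leapfrogAngle δ (hB.eigenvalues j))) ^ 2
    let s := Finset.range ⌈10 * Real.pi / √α / δ⌉₊
    ((L R).bind ⇑(hmcKernel B α δ ^ (K + 1))).real A
      = (∑ k ∈ s, ((L fun j => Real.cos (k * leapfrogAngle δ (hB.eigenvalues j)) * R j).bind
          ⇑(hmcKernel B α δ ^ K)).real A) / s.card := by
  intro L s
  have := isMarkovKernel_hmcKernel hB hα hδ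
  have := isMarkovKernel_pow (hmcKernel B α δ) K
  have h_assoc : (L R).bind ⇑(hmcKernel B α δ ^ (K + 1))
      = ((L R).bind (hmcKernel B α δ)).bind ⇑(hmcKernel B α δ ^ K) := by
    rw [pow_succ]
    exact Measure.comp_assoc.symm
  rw [h_assoc, bind_conditionalLaw_hmcKernel hB hα hδ h0 h1 y hR, stepCounts_eq_range α hδ,
    Measure.bind_bind Measurable.of_discrete.aemeasurable (Kernel.aemeasurable _),
    bind_uniformOn_real _ _ hA]

theorem sq_hmcKernel_pow_sub_target_le (hα : 0 < α) (hδ : 0 < δ) (hlo : ∀ j, α ≤ hB.eigenvalues j)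
    (h1 : ∀ j, δ ^ 2 * hB.eigenvalues j ≤ 1 / 4) (x : Vec d) (K : ℕ) {A : Set (Vec d)}
    (hA : MeasurableSet A) :
    (((hmcKernel B α δ ^ K) x).real A - (target B).real A) ^ 2
      ≤ ∑ j, 8 / 7 * (δ ^ 2 * hB.eigenvalues j / 4) ^ 2 + (3 / 4) ^ K
        * ∑ j, (8 / 7 + hB.eigenvalues j * coordEquiv hB.eigenvectorBasis x j ^ 2 / 2) := by
  have h0 (j : Fin d) : 0 < hB.eigenvalues j := hα.trans_le (hlo j)
  let L := conditionalLaw hB.eigenvectorBasis (coordEquiv hB.eigenvectorBasis x)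
    fun j => (δ / Real.sin (leapfrogAngle δ (hB.eigenvalues j))) ^ 2
  let w (j : Fin d) := 8 / 7 + hB.eigenvalues j * coordEquiv hB.eigenvectorBasis x j ^ 2 / 2
  have hw (j : Fin d) : 0 ≤ w j := by have := h0 j; positivity
  let s := Finset.range ⌈10 * Real.pi / √α / δ⌉₊
  have hs : s.Nonempty := Finset.nonempty_range_iff.2 (ceil_steps_pos hα hδ).ne'
  have h_average (j : Fin d) :
      (∑ k ∈ s, Real.cos (k * leapfrogAngle δ (hB.eigenvalues j)) ^ 2) / s.card ≤ 3 / 4 := by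
    rw [Finset.card_range]
    exact average_cos_leapfrogAngle_sq_le hα (hlo j) hδ ((h1 j).trans (by norm_num))
      (Nat.le_ceil _)
  have h_succ (K : ℕ) (R : Fin d → ℝ) (hR : ∀ j, |R j| ≤ 1) :=
    congrArg (· - (target B).real A) <| bind_hmcKernel_pow_succ_real hB hα hδ h0
      (fun j => (h1 j).trans_lt (by norm_num)) (coordEquiv hB.eigenvectorBasis x) hR K hA
  have h_zero (R : Fin d → ℝ) (hR : ∀ j, |R j| ≤ 1) :
      (((L R).bind ⇑(hmcKernel B α δ ^ 0)).real A - (target B).real A) ^ 2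
        ≤ ∑ j, 8 / 7 * (δ ^ 2 * hB.eigenvalues j / 4) ^ 2 + ∑ j, w j * R j ^ 2 := by
    rw [show (L R).bind ⇑(hmcKernel B α δ ^ 0) = L R from Measure.id_comp]
    exact sq_conditionalLaw_sub_target_le hB hδ.ne' h0 h1 _ hR hA
  have h_start : (L 1).bind ⇑(hmcKernel B α δ ^ K) = (hmcKernel B α δ ^ K) x := by
    rw [show L 1 = Measure.dirac x from conditionalLaw_one _ _ x,
      Measure.dirac_bind (Kernel.measurable _)]
  have h_contract := sq_le_of_eq_average hs
    (φ := fun K R => ((L R).bind ⇑(hmcKernel B α δ ^ K)).real A - (target B).real A)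
    (fun k j => Real.abs_cos_le_one (k * leapfrogAngle δ (hB.eigenvalues j)))
    (by norm_num) h_average
    (fun K R hR => (h_succ K R hR).trans <| by
      rw [Finset.sum_sub_distrib, Finset.sum_const, nsmul_eq_mul, sub_div,
        mul_div_cancel_left₀ _ (by exact_mod_cast hs.card_ne_zero)])
    hw h_zero K (R := 1) (fun j => by simp)
  simpa only [h_start, Pi.one_apply, one_pow, mul_one] using h_contract

include hB in
theorem map_output_hmcProg (hα : 0 < α) (hδ : 0 < δ) (K : ℕ) (x : Vec d) :
    (drawsLaw d α δ K).map (fun ξ => (hmcProg δ K ξ x).output (gradient (potential B)))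
      = (hmcKernel B α δ ^ K) x := by
  have := isProbabilityMeasure_drawLaw d hα hδ
  simp only [output_hmcProg]
  exact map_randomMapIterate (measurable_hmcStep δ (measurable_gradient_potential hB)) x K

end DistanceToTarget

/-! ### Step size and number of transitions -/

theorem sum_coordEquiv_sq_le {ι : Type*} [Fintype ι] {d : ℕ} (b : OrthonormalBasis ι ℝ (Vec d))
    (x : Vec d) : ∑ j, coordEquiv b x j ^ 2 ≤ d * supNorm x ^ 2 := by
  have h_parseval : ∑ j, coordEquiv b x j ^ 2 = ∑ i, x i ^ 2 := by
    simp only [coordEquiv_apply, ← EuclideanSpace.real_norm_sq_eq, b.repr.norm_map]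
  rw [h_parseval]
  calc ∑ i, x i ^ 2 ≤ ∑ _i : Fin d, supNorm x ^ 2 :=
        Finset.sum_le_sum fun i _ => sq_le_sq.2 ((norm_le_pi_norm x.ofLp i).trans (le_abs_self _))
    _ = d * supNorm x ^ 2 := by simp

theorem sq_step_mul_sqrt_le {d β ε δ c : ℝ} (hd : 0 < d) (hβ : 0 < β) (hε : 0 ≤ ε) (hδ : 0 ≤ δ)
    (h : δ ≤ c * (√ε / (√β * d ^ (1 / 4 : ℝ)))) : δ ^ 2 * β * √d ≤ c ^ 2 * ε := by
  have h_root : (d ^ (1 / 4 : ℝ)) ^ 2 = √d := by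
    rw [← Real.rpow_natCast, ← Real.rpow_mul hd.le, Real.sqrt_eq_rpow]
    norm_num
  have : 0 < √d := Real.sqrt_pos.2 hd
  calc δ ^ 2 * β * √d ≤ (c * (√ε / (√β * d ^ (1 / 4 : ℝ)))) ^ 2 * β * √d := by gcongr
    _ = c ^ 2 * ε := by
      rw [mul_pow, div_pow, mul_pow, h_root, Real.sq_sqrt hε, Real.sq_sqrt hβ.le]
      field_simp

theorem three_quarters_pow_le {a : ℝ} (ha : 1 < a) {K : ℕ} (hK : 20 * Real.log a ≤ K) :
    (3 / 4 : ℝ) ^ K ≤ 5 / 6 * (a ^ 2)⁻¹ := by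
  have hK0 : K ≠ 0 := by
    rintro rfl
    have := Real.log_pos ha
    norm_num at hK
    linarith
  have h_exp : (9 / 10 : ℝ) ≤ Real.exp (-(1 / 10)) := by
    linarith [Real.one_sub_le_exp_neg (1 / 10 : ℝ)]
  calc (3 / 4 : ℝ) ^ K = (5 / 6) ^ K * (9 / 10) ^ K := by
        rw [← mul_pow]
        norm_num
    _ ≤ 5 / 6 * Real.exp (-(1 / 10)) ^ K := by
        gcongr
        exact pow_le_of_le_one (by norm_num) (by norm_num) hK0
    _ = 5 / 6 * Real.exp (-(K / 10)) := by
        rw [← Real.exp_nat_mul]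
        ring_nf
    _ ≤ 5 / 6 * Real.exp (-(2 * Real.log a)) := by
        gcongr
        linarith
    _ = 5 / 6 * (a ^ 2)⁻¹ := by
        rw [Real.exp_neg, two_mul, Real.exp_add, Real.exp_log (by linarith), sq]

theorem sum_initial_weight_le {d : ℕ} (hd : 1 ≤ d) {α β S : ℝ} (hα : 0 < α) (hαβ : α ≤ β)
    {l y : Fin d → ℝ} (hl : ∀ j, l j ≤ β) (hS : 0 ≤ S) (hy : ∑ j, y j ^ 2 ≤ d * S ^ 2) :
    ∑ j, (8 / 7 + l j * y j ^ 2 / 2) ≤ 8 / 7 * (d * (β / α) * (√α * S + 1)) ^ 2 := by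
  have hβ : 0 < β := hα.trans_le hαβ
  have hκ : 1 ≤ β / α := (one_le_div hα).2 hαβ
  have h_cond : 1 ≤ d * (β / α) := one_le_mul_of_one_le_of_one_le (by exact_mod_cast hd) hκ
  have h_sq : α * S ^ 2 + 1 ≤ (√α * S + 1) ^ 2 := by
    nlinarith [Real.sq_sqrt hα.le, mul_nonneg (Real.sqrt_nonneg α) hS]
  calc ∑ j, (8 / 7 + l j * y j ^ 2 / 2) ≤ ∑ j, (8 / 7 + β / 2 * y j ^ 2) :=
        Finset.sum_le_sum fun j _ => by
          linarith [mul_le_mul_of_nonneg_right (hl j) (sq_nonneg (y j))]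
    _ = 8 / 7 * d + β / 2 * ∑ j, y j ^ 2 := by
        rw [Finset.sum_add_distrib, Finset.sum_const, Finset.card_univ, Fintype.card_fin,
          nsmul_eq_mul, ← Finset.mul_sum, mul_comm (d : ℝ)]
    _ ≤ 8 / 7 * (d * (β / α)) + 8 / 7 * (β * (d * S ^ 2)) := by
        have h_dim : d ≤ d * (β / α) := le_mul_of_one_le_right (Nat.cast_nonneg d) hκ
        have h_norm := mul_le_mul_of_nonneg_left hy hβ.le
        have h_nonneg : 0 ≤ β * (d * S ^ 2) := by positivity
        linarith
    _ = 8 / 7 * (d * (β / α) * (α * S ^ 2 + 1)) := by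
        field_simp
        ring
    _ ≤ 8 / 7 * ((d * (β / α)) ^ 2 * (√α * S + 1) ^ 2) := by
        gcongr
        exact le_self_pow₀ h_cond two_ne_zero
    _ = 8 / 7 * (d * (β / α) * (√α * S + 1)) ^ 2 := by rw [← mul_pow]

theorem sum_bias_le {d : ℕ} {β δ ε : ℝ} {l : Fin d → ℝ} (hβ : 0 ≤ β) (hl0 : ∀ j, 0 ≤ l j)
    (hl : ∀ j, l j ≤ β) (hδ : δ ^ 2 * β * √d ≤ ε) :
    ∑ j, 8 / 7 * (δ ^ 2 * l j / 4) ^ 2 ≤ ε ^ 2 / 14 := by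
  calc ∑ j, 8 / 7 * (δ ^ 2 * l j / 4) ^ 2 ≤ ∑ _j : Fin d, 8 / 7 * (δ ^ 2 * β / 4) ^ 2 := by
        gcongr with j
        · have := hl0 j
          positivity
        · exact hl j
    _ = (δ ^ 2 * β * √d) ^ 2 / 14 := by
        rw [mul_pow _ √_, Real.sq_sqrt (Nat.cast_nonneg _), Finset.sum_const, Finset.card_univ,
          Fintype.card_fin, nsmul_eq_mul]
        ring
    _ ≤ ε ^ 2 / 14 := by gcongr

section Bounds

variable {d : ℕ} {B : Matrix (Fin d) (Fin d) ℝ} {α β δ ε : ℝ}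

theorem tvDist_hmcKernel_pow_le (hd : 1 ≤ d) (hB : B.IsHermitian) (hα : 0 < α) (hαβ : α ≤ β)
    (hlo : ∀ j, α ≤ hB.eigenvalues j) (hhi : ∀ j, hB.eigenvalues j ≤ β) (hε : 0 < ε) (x : Vec d)
    {K : ℕ} (hδ : 0 < δ) (hK : 20 * Real.log (d * (β / α) * (√α * supNorm x + 1) / ε) ≤ K)
    (hstep : δ ≤ 1 / 2 * (√ε / (√β * (d : ℝ) ^ (1 / 4 : ℝ)))) :
    tvDist ((hmcKernel B α δ ^ K) x) (target B) ≤ ε := by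
  have h0 (j : Fin d) : 0 < hB.eigenvalues j := hα.trans_le (hlo j)
  have := isMarkovKernel_hmcKernel hB hα hδ
  have := isMarkovKernel_pow (hmcKernel B α δ) K
  have : IsProbabilityMeasure (target B) := by
    rw [target_eq_basisGaussian hB h0]
    infer_instance
  refine tvDist_le hε.le fun A hA => ?_
  rcases le_or_gt 1 ε with hε1 | hε1
  · exact sq_measureReal_sub_le_one.trans (one_le_pow₀ hε1)
  have hd1 : (1 : ℝ) ≤ d := by exact_mod_cast hd
  have hβ : 0 < β := hα.trans_le hαβ
  have h_step : δ ^ 2 * β * √d ≤ ε / 4 := by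
    linarith [sq_step_mul_sqrt_le (by linarith) hβ hε.le hδ.le hstep]
  have h_small (j : Fin d) : δ ^ 2 * hB.eigenvalues j ≤ 1 / 4 :=
    calc δ ^ 2 * hB.eigenvalues j ≤ δ ^ 2 * β := by gcongr; exact hhi j
      _ ≤ δ ^ 2 * β * √d := le_mul_of_one_le_right (by positivity) (Real.one_le_sqrt.2 hd1)
      _ ≤ 1 / 4 := by linarith
  have hS : 0 ≤ supNorm x := norm_nonneg _
  set M := d * (β / α) * (√α * supNorm x + 1)
  have hM1 : 1 ≤ M := one_le_mul_of_one_le_of_one_le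
    (one_le_mul_of_one_le_of_one_le hd1 ((one_le_div hα).2 hαβ))
    (le_add_of_nonneg_left (by positivity))
  have h_bias := sum_bias_le hβ.le (fun j => (h0 j).le) hhi h_step
  have h_weight := sum_initial_weight_le hd hα hαβ hhi hS
    (sum_coordEquiv_sq_le hB.eigenvectorBasis x)
  calc _ ≤ _ := sq_hmcKernel_pow_sub_target_le hB hα hδ hlo h_small x K hA
    _ ≤ (ε / 4) ^ 2 / 14 + 5 / 6 * ((M / ε) ^ 2)⁻¹ * (8 / 7 * M ^ 2) := by
        refine add_le_add h_bias (mul_le_mul ?_ h_weight ?_ (by positivity))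
        · exact three_quarters_pow_le ((one_lt_div hε).2 (hε1.trans_le hM1)) hK
        · exact Finset.sum_nonneg fun j _ => by have := h0 j; positivity
    _ = (1 / 224 + 20 / 21) * ε ^ 2 := by
        field_simp
        ring
    _ ≤ ε ^ 2 := by linarith [sq_nonneg ε]

theorem ae_queries_hmcProg_le_of_le_step (g : Vec d → Vec d) (hd : 1 ≤ d) (hα : 0 < α)
    (hβ : 0 < β) (hε : 0 < ε) (hδ : 0 < δ) {c : ℝ} (hc : 0 < c)
    (hstep : c * (√ε / (√β * (d : ℝ) ^ (1 / 4 : ℝ))) ≤ δ) (K : ℕ) (x : Vec d) :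
    ∀ᵐ ξ ∂drawsLaw d α δ K, ((hmcProg δ K ξ x).queries g : ℝ)
      ≤ 20 * Real.pi / c * (√(β / α) * (d : ℝ) ^ (1 / 4 : ℝ) * K / √ε) := by
  filter_upwards [ae_queries_hmcProg_le g hα hδ K x] with ξ hξ
  have : (0 : ℝ) < d := by exact_mod_cast hd
  calc ((hmcProg δ K ξ x).queries g : ℝ) ≤ K * (2 * (10 * Real.pi / √α / δ)) := hξ
    _ ≤ K * (2 * (10 * Real.pi / √α / (c * (√ε / (√β * (d : ℝ) ^ (1 / 4 : ℝ)))))) := by gcongr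
    _ = 20 * Real.pi / c * (√(β / α) * (d : ℝ) ^ (1 / 4 : ℝ) * K / √ε) := by
        rw [Real.sqrt_div hβ.le]
        field_simp
        ring

end Bounds

end UnadjustedHMC

end

open UnadjustedHMC

theorem mainTheorem4 :
    ∃ C C' C'' : ℝ, 0 < C ∧ 0 < C' ∧ C' ≤ 1 ∧ 0 < C'' ∧
      ∀ (d : ℕ) (_ : 1 ≤ d) (α β : ℝ) (_ : 0 < α) (_ : α ≤ β)
        (B : Matrix (Fin d) (Fin d) ℝ)
        (_ : (B - α • (1 : Matrix (Fin d) (Fin d) ℝ)).PosSemidef)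
        (_ : (β • (1 : Matrix (Fin d) (Fin d) ℝ) - B).PosSemidef)
        (ε : ℝ) (_ : 0 < ε) (x : Vec d) (K : ℕ) (δ : ℝ) (_ : 0 < δ)
        (_ : C * Real.log (d * (β / α) * (√α * supNorm x + 1) / ε) ≤ K)
        (_ : δ ≤ C' * (√ε / (√β * (d : ℝ) ^ (1 / 4 : ℝ)))),
        -- closeness in total variation of the `K`-step distribution to the target
        tvDist ((hmcKernel B α δ ^ K) x) (target B) ≤ ε ∧
        -- the algorithm with gradient oracle returns a sample from the `K`-step distribution
        (drawsLaw d α δ K).map (fun ξ => (hmcProg δ K ξ x).output (gradient (potential B)))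
          = (hmcKernel B α δ ^ K) x ∧
        -- and its number of gradient evaluations is bounded, for `δ` of the allowed order
        ∀ c : ℝ, 0 < c → c * (√ε / (√β * (d : ℝ) ^ (1 / 4 : ℝ))) ≤ δ →
          ∀ᵐ ξ ∂(drawsLaw d α δ K),
            ((hmcProg δ K ξ x).queries (gradient (potential B)) : ℝ)
              ≤ C'' / c * (√(β / α) * (d : ℝ) ^ (1 / 4 : ℝ) * K / √ε) := by
  refine ⟨20, 1 / 2, 20 * Real.pi, by norm_num, by norm_num, by norm_num,
    mul_pos (by norm_num) Real.pi_pos, ?_⟩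
  intro d hd α β hα hαβ B hlo hhi ε hε x K δ hδ hK hstep
  have hB : B.IsHermitian := isHermitian_of_posSemidef_sub_smul_one hlo
  refine ⟨?_, map_output_hmcProg hB hα hδ K x, ?_⟩
  · exact tvDist_hmcKernel_pow_le hd hB hα hαβ (le_eigenvalues_of_posSemidef_sub hB hlo)
      (eigenvalues_le_of_posSemidef_sub hB hhi) hε x hδ hK hstep
  · intro c hc hcδ
    exact ae_queries_hmcProg_le_of_le_step _ hd hα (hα.trans_le hαβ) hε hδ hc hcδ K x
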